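/- Let $n\ge 1$, $s\in(0,1)$, and let $\Omega\subset\mathbb R^n$ be a nonempty bounded open set. Let $G(t)=\int_0^t g(\tau)\,d\tau$ $(t\ge 0)$ be a Young function, i.e. $g$ is right continuous on $[0,\infty)$, $g(0)=0$, $g>0$ and nondecreasing on $(0,\infty)$, and $g(t)\to\infty$ as $t\to\infty$; assume that for some constants $p^\pm$ $$1<p^-\le \frac{t\,g(t)}{G(t)}\le p^+<\infty\qquad\text{for all } t>0 .$$ Let $\beta\in L^\infty(\mathbb R^n\setminus\Omega)$ be strictly positive a.e. Put $D_su(x,y)=\frac{u(x)-u(y)}{|x-y|^s}$ and, for measurable $u$, $$\Phi_{G,\Omega}(u)=\int_\Omega G(|u|)\,dx,\qquad \Phi_{G,\beta,\Omega^c}(u)=\int_{\mathbb R^n\setminus\Omega}\beta\,G(|u|)\,dx,$$ and let $\Phi_{s,G,\mathbb R^n}(u)$, $\Phi_{s,G,\Omega}(u)$, $\Phi_{s,G,*}(u)$ be the integral of $G(|D_su(x,y)|)\,|x-y|^{-n}$ with respect to $dx\,dy$ over $\mathbb R^n\times\mathbb R^n$, over $\Omega\times\Omega$ and over $\mathbb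 R^{2n}\setminus(\Omega^c)^2$, respectively, where $\Omega^c=\mathbb R^n\setminus\Omega$. Let - $W^{s,G}_0(\Omega)$ be the set of measurable $u:\mathbb R^n\to\mathbb R$ with $\int_{\mathbb R^n}G(|u|)\,dx<\infty$, $\Phi_{s,G,\mathbb R^n}(u)<\infty$ and $u=0$ a.e. in $\mathbb R^n\setminus\Omega$; - $W^{s,G}_*(\Omega)$ be the set of measurable $u:\mathbb R^n\to\mathbb R$ with $\Phi_{G,\Omega}(u)<\infty$ and $\Phi_{s,G,*}(u)<\infty$; - $W^{s,G}_{reg}(\Omega)$ be the set of measurable $u:\Omega\to\mathbb R$ with $\Phi_{G,\Omega}(u)<\infty$ and $\Phi_{s,G,\Omega}(u)<\infty$; - $\mathcal X$ be the set of measurable $u:\mathbb R^n\to\mathbb R$ with $\Phi_{s,G,*}(u)+\Phi_{G,\Omega}(u)+\Phi_{G,\beta,\Omega^c}(u)<\infty$. Then for each $\mu>0$ the four infima $$\Lambda_D=\inf_{u\in W^{s,G}_0(\Omega),\ \Phi_{G,\Omega}(u)=\mu}\frac{\Phi_{s,G,\mathbb R^n}(u)+\Phi_{G,\Omega}(u)}{\Phi_{G,\Omega}(u)},\qquad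 \Lambda_N=\inf_{u\in W^{s,G}_*(\Omega),\ \Phi_{G,\Omega}(u)=\mu}\frac{\Phi_{s,G,*}(u)+\Phi_{G,\Omega}(u)}{\Phi_{G,\Omega}(u)},$$ $$\Lambda_{\tilde N}=\inf_{u\in W^{s,G}_{reg}(\Omega),\ \Phi_{G,\Omega}(u)=\mu}\frac{\Phi_{s,G,\Omega}(u)+\Phi_{G,\Omega}(u)}{\Phi_{G,\Omega}(u)},\qquad \Lambda_R=\inf_{u\in\mathcal X,\ \Phi_{G,\Omega}(u)=\mu}\frac{\Phi_{s,G,*}(u)+\Phi_{G,\Omega}(u)+\Phi_{G,\beta,\Omega^c}(u)}{\Phi_{G,\Omega}(u)}$$ are all attained, i.e. each of them is the value of the corresponding quotient at some function in the corresponding constraint set. -/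

import Mathlib

open MeasureTheory Set Filter Topology
open scoped ENNReal

noncomputable section

namespace FracOrlicz

/-- `G` is a Young function with density `g`: `G t = ∫₀ᵗ g` for `t ≥ 0`, where `g` is right
continuous on `[0, ∞)`, vanishes at `0`, is positive and nondecreasing on `(0, ∞)`, and tends to
infinity. Only the values of `g` and `G` on `[0, ∞)` matter. -/
structure IsYoungFunction (g G : ℝ → ℝ) : Prop where
  right_continuous : ∀ t, 0 ≤ t → ContinuousWithinAt g (Ici t) t
  zero : g 0 = 0
  pos : ∀ t, 0 < t → 0 < g t
  mono : MonotoneOn g (Ioi 0)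
  tendsto_atTop : Tendsto g atTop atTop
  eq_integral : ∀ t, 0 ≤ t → G t = ∫ τ in (0 : ℝ)..t, g τ

/-- The growth condition `1 < p⁻ ≤ t g(t) / G(t) ≤ p⁺ < ∞` for all `t > 0`. -/
def GrowthCondition (g G : ℝ → ℝ) (pm pp : ℝ) : Prop :=
  1 < pm ∧ ∀ t, 0 < t → pm ≤ t * g t / G t ∧ t * g t / G t ≤ pp

variable {n : ℕ}

/-- The `s`-Hölder quotient `D_s u (x, y) = (u x - u y) / |x - y|^s`. -/
def holderQuotient (s : ℝ) (u : EuclideanSpace ℝ (Fin n) → ℝ)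
    (x y : EuclideanSpace ℝ (Fin n)) : ℝ :=
  (u x - u y) / ‖x - y‖ ^ s

/-- The modular `Φ_{G,Ω}(u) = ∫_Ω G(|u|) dx`. -/
def modular (G : ℝ → ℝ) (Ω : Set (EuclideanSpace ℝ (Fin n)))
    (u : EuclideanSpace ℝ (Fin n) → ℝ) : ℝ≥0∞ :=
  ∫⁻ x in Ω, ENNReal.ofReal (G |u x|)

/-- The weighted modular `Φ_{G,β,A}(u) = ∫_A β G(|u|) dx`. -/
def weightedModular (G : ℝ → ℝ) (β : EuclideanSpace ℝ (Fin n) → ℝ)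
    (A : Set (EuclideanSpace ℝ (Fin n))) (u : EuclideanSpace ℝ (Fin n) → ℝ) : ℝ≥0∞ :=
  ∫⁻ x in A, ENNReal.ofReal (β x * G |u x|)

/-- The double integral `∬_A G(|D_s u(x,y)|) dx dy / |x - y|^n` over `A ⊆ ℝⁿ × ℝⁿ`. -/
def fracModularOn (s : ℝ) (G : ℝ → ℝ)
    (A : Set (EuclideanSpace ℝ (Fin n) × EuclideanSpace ℝ (Fin n)))
    (u : EuclideanSpace ℝ (Fin n) → ℝ) : ℝ≥0∞ :=
  ∫⁻ z in A, ENNReal.ofReal (G |holderQuotient s u z.1 z.2| / ‖z.1 - z.2‖ ^ n)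

/-- `Φ_{s,G,Ω}`: the double integral over `Ω × Ω`; for `Ω = univ` this is `Φ_{s,G,ℝⁿ}`. -/
def fracModular (s : ℝ) (G : ℝ → ℝ) (Ω : Set (EuclideanSpace ℝ (Fin n)))
    (u : EuclideanSpace ℝ (Fin n) → ℝ) : ℝ≥0∞ :=
  fracModularOn s G (Ω ×ˢ Ω) u

/-- `Φ_{s,G,*}`: the double integral over `ℝ²ⁿ \ (Ωᶜ)²`. -/
def fracModularStar (s : ℝ) (G : ℝ → ℝ) (Ω : Set (EuclideanSpace ℝ (Fin n)))
    (u : EuclideanSpace ℝ (Fin n) → ℝ) : ℝ≥0∞ :=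
  fracModularOn s G (Ωᶜ ×ˢ Ωᶜ)ᶜ u

/-! The function spaces are sets of (Lebesgue measurable) functions on `ℝⁿ`; elements of
`LG G Ω` and of `WReg s G Ω` are only constrained on `Ω`, where alone their values matter. -/

/-- `L^G(Ω)`. -/
def LG (G : ℝ → ℝ) (Ω : Set (EuclideanSpace ℝ (Fin n))) :
    Set (EuclideanSpace ℝ (Fin n) → ℝ) :=
  {u | AEMeasurable u (volume.restrict Ω) ∧ modular G Ω u < ∞}

/-- `W^{s,G}_{reg}(Ω)`; for `Ω = univ` this is `W^{s,G}(ℝⁿ)`. -/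
def WReg (s : ℝ) (G : ℝ → ℝ) (Ω : Set (EuclideanSpace ℝ (Fin n))) :
    Set (EuclideanSpace ℝ (Fin n) → ℝ) :=
  {u | u ∈ LG G Ω ∧ fracModular s G Ω u < ∞}

/-- `W^{s,G}_0(Ω)`: functions of `W^{s,G}(ℝⁿ)` vanishing a.e. outside `Ω`. -/
def WZero (s : ℝ) (G : ℝ → ℝ) (Ω : Set (EuclideanSpace ℝ (Fin n))) :
    Set (EuclideanSpace ℝ (Fin n) → ℝ) :=
  {u | u ∈ WReg s G univ ∧ ∀ᵐ x ∂(volume.restrict Ωᶜ), u x = 0}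

/-- `W^{s,G}_*(Ω)`: measurable functions on `ℝⁿ` in `L^G(Ω)` with `Φ_{s,G,*}` finite. -/
def WStar (s : ℝ) (G : ℝ → ℝ) (Ω : Set (EuclideanSpace ℝ (Fin n))) :
    Set (EuclideanSpace ℝ (Fin n) → ℝ) :=
  {u | AEMeasurable u volume ∧ u ∈ LG G Ω ∧ fracModularStar s G Ω u < ∞}

/-- The Robin space `𝒳`: measurable functions on `ℝⁿ` with
`Φ_{s,G,*}(u) + Φ_{G,Ω}(u) + Φ_{G,β,Ωᶜ}(u) < ∞`. -/
def XSpace (s : ℝ) (G : ℝ → ℝ) (β : EuclideanSpace ℝ (Fin n) → ℝ)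
    (Ω : Set (EuclideanSpace ℝ (Fin n))) : Set (EuclideanSpace ℝ (Fin n) → ℝ) :=
  {u | AEMeasurable u volume ∧
    fracModularStar s G Ω u + modular G Ω u + weightedModular G β Ωᶜ u < ∞}

/-- The functions of a space `W` at energy level `m`: `{u ∈ W : Φ_{G,Ω}(u) = m}`. -/
def constraintSet (W : Set (EuclideanSpace ℝ (Fin n) → ℝ)) (G : ℝ → ℝ)
    (Ω : Set (EuclideanSpace ℝ (Fin n))) (m : ℝ) : Set (EuclideanSpace ℝ (Fin n) → ℝ) :=
  {u | u ∈ W ∧ modular G Ω u = ENNReal.ofReal m}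

/-- The Dirichlet quotient. -/
def quotientD (s : ℝ) (G : ℝ → ℝ) (Ω : Set (EuclideanSpace ℝ (Fin n)))
    (u : EuclideanSpace ℝ (Fin n) → ℝ) : ℝ≥0∞ :=
  (fracModular s G univ u + modular G Ω u) / modular G Ω u

/-- The Neumann quotient. -/
def quotientN (s : ℝ) (G : ℝ → ℝ) (Ω : Set (EuclideanSpace ℝ (Fin n)))
    (u : EuclideanSpace ℝ (Fin n) → ℝ) : ℝ≥0∞ :=
  (fracModularStar s G Ω u + modular G Ω u) / modular G Ω u

/-- The regional Neumann quotient. -/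
def quotientReg (s : ℝ) (G : ℝ → ℝ) (Ω : Set (EuclideanSpace ℝ (Fin n)))
    (u : EuclideanSpace ℝ (Fin n) → ℝ) : ℝ≥0∞ :=
  (fracModular s G Ω u + modular G Ω u) / modular G Ω u

/-- The Robin quotient. -/
def quotientR (s : ℝ) (G : ℝ → ℝ) (β : EuclideanSpace ℝ (Fin n) → ℝ)
    (Ω : Set (EuclideanSpace ℝ (Fin n))) (u : EuclideanSpace ℝ (Fin n) → ℝ) : ℝ≥0∞ :=
  (fracModularStar s G Ω u + modular G Ω u + weightedModular G β Ωᶜ u) / modular G Ω u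

/-- `Λ_D` at energy level `m`. -/
def LambdaD (s : ℝ) (G : ℝ → ℝ) (Ω : Set (EuclideanSpace ℝ (Fin n))) (m : ℝ) : ℝ≥0∞ :=
  ⨅ u ∈ constraintSet (WZero s G Ω) G Ω m, quotientD s G Ω u

/-- `Λ_N` at energy level `m`. -/
def LambdaN (s : ℝ) (G : ℝ → ℝ) (Ω : Set (EuclideanSpace ℝ (Fin n))) (m : ℝ) : ℝ≥0∞ :=
  ⨅ u ∈ constraintSet (WStar s G Ω) G Ω m, quotientN s G Ω u

/-- `Λ_Ñ` (regional Neumann) at energy level `m`. -/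
def LambdaReg (s : ℝ) (G : ℝ → ℝ) (Ω : Set (EuclideanSpace ℝ (Fin n))) (m : ℝ) : ℝ≥0∞ :=
  ⨅ u ∈ constraintSet (WReg s G Ω) G Ω m, quotientReg s G Ω u

/-- `Λ_R` at energy level `m`. -/
def LambdaR (s : ℝ) (G : ℝ → ℝ) (β : EuclideanSpace ℝ (Fin n) → ℝ)
    (Ω : Set (EuclideanSpace ℝ (Fin n))) (m : ℝ) : ℝ≥0∞ :=
  ⨅ u ∈ constraintSet (XSpace s G β Ω) G Ω m, quotientR s G β Ω u

end FracOrlicz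

end

namespace FracOrlicz

/-- The consequences of `IsYoungFunction` and `GrowthCondition` for the even extension
`t ↦ G |t|` on which the variational argument relies. -/
structure IsDoublingYoung (G : ℝ → ℝ) : Prop where
  convex : ConvexOn ℝ univ fun t => G |t|
  zero : G 0 = 0
  pos : ∀ t, 0 < t → 0 < G t
  doubling : ∀ L : ℝ, ∃ K : ℝ, 0 < K ∧ ∀ t, G |L * t| ≤ K * G |t|
  near_one : ∀ ε : ℝ, 0 < ε → ∃ l : ℝ, 1 < l ∧ ∀ t, G |l * t| ≤ (1 + ε) * G |t|

section Young

variable {g G : ℝ → ℝ} {pm pp : ℝ}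

theorem IsYoungFunction.monotoneOn_Ici (h : IsYoungFunction g G) : MonotoneOn g (Ici 0) := by
  intro a ha b hb hab
  rcases eq_or_lt_of_le (show (0 : ℝ) ≤ a from ha) with rfl | ha'
  · rw [h.zero]
    rcases eq_or_lt_of_le hab with rfl | hb'
    · exact h.zero.ge
    · exact (h.pos _ hb').le
  · exact h.mono ha' (lt_of_lt_of_le ha' hab) hab

theorem IsYoungFunction.sub_eq (h : IsYoungFunction g G) {a b : ℝ} (ha : 0 ≤ a) (hab : a ≤ b) :
    G b - G a = ∫ τ in a..b, g τ := by
  have hi : ∀ x y : ℝ, 0 ≤ x → 0 ≤ y → IntervalIntegrable g volume x y := fun x y hx hy =>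
    MonotoneOn.intervalIntegrable (h.monotoneOn_Ici.mono fun t ht => (le_min hx hy).trans ht.1)
  rw [h.eq_integral b (ha.trans hab), h.eq_integral a ha]
  exact intervalIntegral.integral_interval_sub_left (hi _ _ le_rfl (ha.trans hab))
    (hi _ _ le_rfl ha)

theorem IsYoungFunction.sub_bounds (h : IsYoungFunction g G) {a b : ℝ} (ha : 0 ≤ a)
    (hab : a ≤ b) : (b - a) * g a ≤ G b - G a ∧ G b - G a ≤ (b - a) * g b := by
  have hi : IntervalIntegrable g volume a b :=
    MonotoneOn.intervalIntegrable (h.monotoneOn_Ici.mono fun t ht => by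
      rw [uIcc_of_le hab] at ht; exact ha.trans ht.1)
  rw [h.sub_eq ha hab]
  constructor
  · have := intervalIntegral.integral_mono_on hab (intervalIntegrable_const (c := g a)) hi
      fun x hx => h.monotoneOn_Ici ha (ha.trans hx.1) hx.1
    simpa using this
  · have := intervalIntegral.integral_mono_on hab hi (intervalIntegrable_const (c := g b))
      fun x hx => h.monotoneOn_Ici (ha.trans hx.1) (ha.trans hab) hx.2
    simpa using this

theorem IsYoungFunction.nonneg (h : IsYoungFunction g G) {t : ℝ} (ht : 0 ≤ t) : 0 ≤ g t := by
  have := h.monotoneOn_Ici self_mem_Ici ht ht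
  rwa [h.zero] at this

theorem IsYoungFunction.map_zero (h : IsYoungFunction g G) : G 0 = 0 := by
  rw [h.eq_integral 0 le_rfl]; simp

theorem IsYoungFunction.monotoneOn (h : IsYoungFunction g G) : MonotoneOn G (Ici 0) := by
  intro a ha b hb hab
  have := (h.sub_bounds ha hab).1
  nlinarith [h.nonneg ha]

theorem IsYoungFunction.map_pos (h : IsYoungFunction g G) {t : ℝ} (ht : 0 < t) : 0 < G t := by
  have h1 := (h.sub_bounds (half_pos ht).le (half_le_self ht.le)).1
  have h2 := h.monotoneOn self_mem_Ici (half_pos ht).le (half_pos ht).le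
  rw [h.map_zero] at h2
  nlinarith [h.pos _ (half_pos ht)]

theorem IsYoungFunction.convexOn_Ici (h : IsYoungFunction g G) : ConvexOn ℝ (Ici 0) G := by
  refine convexOn_of_slope_mono_adjacent (convex_Ici 0) ?_
  intro x y z hx hz hxy hyz
  have hx : (0 : ℝ) ≤ x := hx
  have h1 := (h.sub_bounds hx hxy.le).2
  have h2 := (h.sub_bounds (hx.trans hxy.le) hyz.le).1
  refine le_trans (b := g y) ?_ ?_
  · rw [div_le_iff₀ (sub_pos.2 hxy)]; linarith
  · rw [le_div_iff₀ (sub_pos.2 hyz)]; linarith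

theorem IsYoungFunction.near_one (h : IsYoungFunction g G) (hp : GrowthCondition g G pm pp)
    {ε : ℝ} (hε : 0 < ε) : ∃ l : ℝ, 1 < l ∧ ∀ t, G |l * t| ≤ (1 + ε) * G |t| := by
  have hpp : 1 < pp := hp.1.trans_le ((hp.2 1 one_pos).1.trans (hp.2 1 one_pos).2)
  set η := ε / ((1 + ε) * pp) with hη
  have hη0 : 0 < η := by positivity
  have hηp : (1 - η * pp) * (1 + ε) = 1 := by rw [hη]; field_simp; ring
  refine ⟨1 + η, by linarith, fun t => ?_⟩
  rw [abs_mul, abs_of_pos (by linarith : 0 < 1 + η)]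
  rcases eq_or_lt_of_le (abs_nonneg t) with ht | ht
  · rw [← ht]; simp [h.map_zero]
  set a := |t|
  have hb : 0 < (1 + η) * a := by positivity
  have hG := h.map_pos hb
  have h1 := (h.sub_bounds ht.le (by nlinarith : a ≤ (1 + η) * a)).2
  have h2 := (hp.2 _ hb).2
  rw [div_le_iff₀ hG] at h2
  have h3 : a * g ((1 + η) * a) ≤ pp * G ((1 + η) * a) := by
    have := mul_nonneg hη0.le (mul_nonneg ht.le (h.nonneg hb.le))
    nlinarith
  have h4 : G ((1 + η) * a) * (1 - η * pp) ≤ G a := by nlinarith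
  calc G ((1 + η) * a) = (G ((1 + η) * a) * (1 - η * pp)) * (1 + ε) := by
        rw [mul_assoc, hηp, mul_one]
    _ ≤ G a * (1 + ε) := by gcongr
    _ = _ := mul_comm _ _

theorem IsYoungFunction.doubling (h : IsYoungFunction g G) (hp : GrowthCondition g G pm pp)
    (L : ℝ) : ∃ K : ℝ, 0 < K ∧ ∀ t, G |L * t| ≤ K * G |t| := by
  obtain ⟨l, hl, hlG⟩ := h.near_one hp one_pos
  obtain ⟨k, hk⟩ := pow_unbounded_of_one_lt |L| hl
  refine ⟨(1 + 1) ^ k, by positivity, fun t => ?_⟩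
  have key : ∀ j : ℕ, G |l ^ j * t| ≤ (1 + 1) ^ j * G |t| := by
    intro j
    induction j with
    | zero => simp
    | succ j ih =>
      calc G |l ^ (j + 1) * t| = G |l * (l ^ j * t)| := by ring_nf
        _ ≤ (1 + 1) * G |l ^ j * t| := hlG _
        _ ≤ (1 + 1) * ((1 + 1) ^ j * G |t|) := by gcongr
        _ = _ := by ring
  refine le_trans (h.monotoneOn (mem_Ici.2 (abs_nonneg _)) (mem_Ici.2 (abs_nonneg _)) ?_) (key k)
  rw [abs_mul, abs_mul, abs_of_pos (by positivity : 0 < l ^ k)]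
  gcongr

theorem IsYoungFunction.isDoublingYoung (h : IsYoungFunction g G)
    (hp : GrowthCondition g G pm pp) : IsDoublingYoung G where
  convex := by
    have him : (fun t : ℝ => |t|) '' univ ⊆ Ici 0 := by
      rintro _ ⟨t, -, rfl⟩; exact abs_nonneg t
    refine ConvexOn.comp (f := fun t : ℝ => |t|) (g := G) (s := univ) ?_ ?_ (h.monotoneOn.mono him)
    · refine h.convexOn_Ici.subset him ?_
      have : (fun t : ℝ => |t|) '' univ = Ici 0 :=
        him.antisymm fun t ht => ⟨t, trivial, abs_of_nonneg ht⟩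
      rw [this]; exact convex_Ici 0
    · refine ⟨convex_univ, fun x _ y _ a b ha hb _ => ?_⟩
      simpa [abs_mul, abs_of_nonneg ha, abs_of_nonneg hb] using abs_add_le (a * x) (b * y)
  zero := h.map_zero
  pos := fun t ht => h.map_pos ht
  doubling := h.doubling hp
  near_one := fun _ hε => h.near_one hp hε

end Young

namespace IsDoublingYoung

variable {G : ℝ → ℝ} (hG : IsDoublingYoung G)
include hG

theorem continuous : Continuous fun t => G |t| :=
  continuousOn_univ.1 (hG.convex.continuousOn isOpen_univ)

theorem nonneg (t : ℝ) : 0 ≤ G |t| := by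
  rcases eq_or_lt_of_le (abs_nonneg t) with ht | ht
  · rw [← ht, hG.zero]
  · exact (hG.pos _ ht).le

theorem mul_le {a : ℝ} (ha : 0 ≤ a) (ha1 : a ≤ 1) (t : ℝ) : G |a * t| ≤ a * G |t| := by
  have := hG.convex.2 (mem_univ t) (mem_univ (0 : ℝ)) ha (sub_nonneg.2 ha1) (by ring)
  simpa [hG.zero] using this

theorem mono {x y : ℝ} (h : |x| ≤ |y|) : G |x| ≤ G |y| := by
  rcases eq_or_lt_of_le (abs_nonneg y) with hy | hy
  · rw [← hy] at h ⊢; rw [le_antisymm h (abs_nonneg x)]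
  · have := hG.mul_le (a := |x| / |y|) (by positivity) ((div_le_one hy).2 h) |y|
    rw [div_mul_cancel₀ _ hy.ne', abs_abs, abs_abs] at this
    exact this.trans (mul_le_of_le_one_left (hG.nonneg y) ((div_le_one hy).2 h))

theorem combo_le {a b : ℝ} (ha : 0 ≤ a) (hb : 0 ≤ b) (hab : a + b = 1) (x y : ℝ) :
    G |a * x + b * y| ≤ a * G |x| + b * G |y| := by
  simpa using hG.convex.2 (mem_univ x) (mem_univ y) ha hb hab

theorem abs_le_one_add (t : ℝ) : |t| ≤ 1 + G |t| / G 1 := by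
  have h1 := hG.pos 1 one_pos
  have h0 : 0 ≤ G |t| / G 1 := div_nonneg (hG.nonneg t) h1.le
  rcases le_total |t| 1 with ht | ht
  · linarith
  · have hpos : 0 < |t| := by linarith
    have := hG.mul_le (a := |t|⁻¹) (by positivity) (inv_le_one_of_one_le₀ ht) |t|
    rw [inv_mul_cancel₀ hpos.ne', abs_one, abs_abs] at this
    have : |t| ≤ G |t| / G 1 := by
      rw [le_div_iff₀ h1]
      calc |t| * G 1 ≤ |t| * (|t|⁻¹ * G |t|) := by gcongr
        _ = G |t| := by field_simp
    linarith

theorem add_le : ∃ K : ℝ, 0 < K ∧ ∀ x y, G |x + y| ≤ K * (G |x| + G |y|) := by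
  obtain ⟨K, hK, h⟩ := hG.doubling 2
  refine ⟨K, hK, fun x y => ?_⟩
  have h1 := hG.combo_le (a := 1 / 2) (b := 1 / 2) (by norm_num) (by norm_num) (by norm_num)
    (2 * x) (2 * y)
  have h2 := h x
  have h3 := h y
  rw [show 1 / 2 * (2 * x) + 1 / 2 * (2 * y) = x + y by ring] at h1
  nlinarith [hG.nonneg x, hG.nonneg y]

end IsDoublingYoung

section ConvexCombinations

theorem sq_sub_div_sqrt_le (a b : ℝ) :
    (a / √(1 + a ^ 2) - b / √(1 + b ^ 2)) ^ 2
      ≤ 4 * (√(1 + a ^ 2) + √(1 + b ^ 2) - 2 * √(1 + (1 / 2 * a + 1 / 2 * b) ^ 2)) := by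
  have hx2 : √(1 + a ^ 2) ^ 2 = 1 + a ^ 2 := Real.sq_sqrt (by positivity)
  have hy2 : √(1 + b ^ 2) ^ 2 = 1 + b ^ 2 := Real.sq_sqrt (by positivity)
  have hz2 : (2 * √(1 + (1 / 2 * a + 1 / 2 * b) ^ 2)) ^ 2 = 4 + (a + b) ^ 2 := by
    rw [mul_pow, Real.sq_sqrt (by positivity)]; ring
  have hx1 : 1 ≤ √(1 + a ^ 2) := Real.one_le_sqrt.2 (by nlinarith [sq_nonneg a])
  have hy1 : 1 ≤ √(1 + b ^ 2) := Real.one_le_sqrt.2 (by nlinarith [sq_nonneg b])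
  have hz0 : 0 ≤ 2 * √(1 + (1 / 2 * a + 1 / 2 * b) ^ 2) := by positivity
  generalize √(1 + a ^ 2) = x at *
  generalize √(1 + b ^ 2) = y at *
  generalize 2 * √(1 + (1 / 2 * a + 1 / 2 * b) ^ 2) = z at *
  have hxy : 0 < x * y := by positivity
  have hab : a * b + 1 ≤ x * y := by
    have : (a * b + 1) ^ 2 ≤ (x * y) ^ 2 := by
      rw [mul_pow, hx2, hy2]; nlinarith [sq_nonneg (a - b)]
    exact abs_le_of_sq_le_sq' this hxy.le |>.2
  have hzle : z ≤ x + y := by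
    refine abs_le_of_sq_le_sq' (?_ : z ^ 2 ≤ (x + y) ^ 2) (by positivity) |>.2
    rw [hz2]; nlinarith
  have h1 : (a / x - b / y) ^ 2 + (1 / x - 1 / y) ^ 2 = (x + y - z) * (x + y + z) / (x * y) := by
    rw [eq_div_iff hxy.ne']
    have hx0 : x ≠ 0 := by positivity
    have hy0 : y ≠ 0 := by positivity
    have e1 : a ^ 2 = x ^ 2 - 1 := by linarith
    have e2 : b ^ 2 = y ^ 2 - 1 := by linarith
    have e3 : (x + y - z) * (x + y + z) = 2 * (x * y - 1 - a * b) := by nlinarith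
    rw [e3]
    field_simp
    ring_nf
    rw [e1, e2]
    ring
  have h2 : (x + y - z) * (x + y + z) / (x * y) ≤ 4 * (x + y - z) := by
    rw [div_le_iff₀ hxy]
    have : x + y + z ≤ 4 * (x * y) := by nlinarith
    nlinarith [sub_nonneg.2 hzle]
  nlinarith [sq_nonneg (1 / x - 1 / y)]

theorem exists_tendsto_of_tendsto_div_sqrt {t : ℕ → ℝ} {τ M : ℝ}
    (h : Tendsto (fun k => t k / √(1 + t k ^ 2)) atTop (𝓝 τ))
    (hM : ∃ᶠ k in atTop, |t k| ≤ M) : ∃ l, Tendsto t atTop (𝓝 l) := by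
  have hsq : ∀ s : ℝ, (s / √(1 + s ^ 2)) ^ 2 = s ^ 2 / (1 + s ^ 2) := fun s => by
    rw [div_pow, Real.sq_sqrt (by positivity)]
  have hτ : τ ^ 2 ≤ M ^ 2 / (1 + M ^ 2) := by
    by_contra! hlt
    have hev := (h.pow 2).eventually_const_lt hlt
    obtain ⟨k, hk, hk'⟩ := (hM.and_eventually hev).exists
    rw [hsq, div_lt_div_iff₀ (by positivity) (by positivity)] at hk'
    have : t k ^ 2 ≤ M ^ 2 := sq_le_sq' (by linarith [(abs_le.1 hk).1]) (abs_le.1 hk).2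
    nlinarith
  have hτ1 : 0 < 1 - τ ^ 2 := by
    have : M ^ 2 / (1 + M ^ 2) < 1 := by rw [div_lt_one (by positivity)]; linarith
    linarith
  refine ⟨τ / √(1 - τ ^ 2), ?_⟩
  have h2 := h.div ((tendsto_const_nhds (x := (1 : ℝ))).sub (h.pow 2)).sqrt
    (Real.sqrt_pos.2 hτ1).ne'
  refine h2.congr fun k => ?_
  have hp : 0 < 1 + t k ^ 2 := by positivity
  have : 1 - (t k / √(1 + t k ^ 2)) ^ 2 = (1 + t k ^ 2)⁻¹ := by
    rw [hsq]; field_simp; ring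
  rw [Pi.div_apply, this, Real.sqrt_inv, div_inv_eq_mul, div_mul_cancel₀ _ (Real.sqrt_pos.2 hp).ne']

variable {α : Type*} [MeasurableSpace α] {ν : Measure α}

theorem convex_integral_abs_le (C : ℝ) :
    Convex ℝ {f : α → ℝ | Integrable f ν ∧ ∫ x, |f x| ∂ν ≤ C} := by
  rintro f ⟨hf, hfC⟩ g ⟨hg, hgC⟩ a b ha hb hab
  have hi : Integrable (a • f + b • g) ν := (hf.smul a).add (hg.smul b)
  refine ⟨hi, ?_⟩
  calc ∫ x, |(a • f + b • g) x| ∂ν ≤ ∫ x, (a * |f x| + b * |g x|) ∂ν := by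
        refine integral_mono hi.abs ((hf.abs.const_mul a).add (hg.abs.const_mul b)) fun x => ?_
        simpa [abs_mul, abs_of_nonneg ha, abs_of_nonneg hb] using abs_add_le (a * f x) (b * g x)
    _ = a * ∫ x, |f x| ∂ν + b * ∫ x, |g x| ∂ν := by
        rw [integral_add (hf.abs.const_mul a) (hg.abs.const_mul b), integral_const_mul,
          integral_const_mul]
    _ ≤ a * C + b * C := by gcongr
    _ = C := by rw [← add_mul, hab, one_mul]

theorem integrable_sqrt_one_add_sq [IsFiniteMeasure ν] {f : α → ℝ} (hf : Integrable f ν) :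
    Integrable (fun x => √(1 + f x ^ 2)) ν := by
  have hc : Continuous fun t : ℝ => √(1 + t ^ 2) := by fun_prop
  refine ((integrable_const (1 : ℝ)).add hf.abs).mono'
    (hc.comp_aestronglyMeasurable hf.1) (Eventually.of_forall fun x => ?_)
  rw [Real.norm_of_nonneg (Real.sqrt_nonneg _)]
  refine Real.sqrt_le_iff.2 ⟨by simp only [Pi.add_apply]; positivity, ?_⟩
  simp only [Pi.add_apply]
  nlinarith [sq_abs (f x), abs_nonneg (f x)]

/-- Almost minimizers of a strictly convex functional along the convex hulls of the tails of a
sequence have increments with summable mean square after a bounded change of variable. -/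
theorem exists_convexCombo_increments [IsFiniteMeasure ν] {u : ℕ → α → ℝ} {C : ℝ}
    (hu : ∀ k, Integrable (u k) ν) (hC : ∀ k, ∫ x, |u k x| ∂ν ≤ C) :
    ∃ v : ℕ → α → ℝ, (∀ k, v k ∈ convexHull ℝ (u '' Ici k)) ∧
      ∀ k, ∫⁻ x, ENNReal.ofReal ((v k x / √(1 + v k x ^ 2)
        - v (k + 1) x / √(1 + v (k + 1) x ^ 2)) ^ 2) ∂ν ≤ ENNReal.ofReal (16 * (1 / 16) ^ k) := by
  set J : (α → ℝ) → ℝ := fun f => ∫ x, √(1 + f x ^ 2) ∂ν with hJ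
  set S : ℕ → Set (α → ℝ) := fun k => convexHull ℝ (u '' Ici k) with hS
  have hSi : ∀ k, ∀ f ∈ S k, Integrable f ν ∧ ∫ x, |f x| ∂ν ≤ C := fun k f hf =>
    convexHull_min (by rintro _ ⟨i, -, rfl⟩; exact ⟨hu i, hC i⟩) (convex_integral_abs_le C) hf
  have hSanti : ∀ {k l}, k ≤ l → S l ⊆ S k := fun {k l} hkl =>
    convexHull_mono (image_mono (Ici_subset_Ici.2 hkl))
  have hSne : ∀ k, u k ∈ S k := fun k => subset_convexHull _ _ (mem_image_of_mem _ self_mem_Ici)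
  have hJ0 : ∀ f, 0 ≤ J f := fun f => integral_nonneg fun x => Real.sqrt_nonneg _
  have hbdd : ∀ k, BddBelow (J '' S k) := fun k => ⟨0, by rintro _ ⟨f, -, rfl⟩; exact hJ0 f⟩
  have hJle : ∀ k, J (u k) ≤ ν.real univ + C := by
    intro k
    calc J (u k) ≤ ∫ x, (1 + |u k x|) ∂ν := by
          refine integral_mono (integrable_sqrt_one_add_sq (hu k))
            ((integrable_const (1 : ℝ)).add (hu k).abs) fun x => ?_
          refine Real.sqrt_le_iff.2 ⟨by positivity, ?_⟩
          nlinarith [sq_abs (u k x), abs_nonneg (u k x)]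
      _ = ν.real univ + ∫ x, |u k x| ∂ν := by
          rw [integral_add (integrable_const _) (hu k).abs]; simp
      _ ≤ _ := by gcongr; exact hC k
  set I : ℕ → ℝ := fun k => sInf (J '' S k) with hI
  have hIle : ∀ k, ∀ f ∈ S k, I k ≤ J f := fun k f hf => csInf_le (hbdd k) (mem_image_of_mem _ hf)
  have hImono : Monotone I := fun k l hkl =>
    csInf_le_csInf (hbdd k) ⟨_, mem_image_of_mem _ (hSne l)⟩ (image_mono (hSanti hkl))
  have hIbdd : BddAbove (range I) :=
    ⟨ν.real univ + C, by rintro _ ⟨k, rfl⟩; exact (hIle k _ (hSne k)).trans (hJle k)⟩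
  set L := ⨆ k, I k
  have hIL : ∀ k, I k ≤ L := fun k => le_ciSup hIbdd k
  have hlim : Tendsto I atTop (𝓝 L) := tendsto_atTop_ciSup hImono hIbdd
  obtain ⟨N, hNmono, hN⟩ := extraction_forall_of_eventually
    (P := fun k m => L - (1 / 16 : ℝ) ^ k < I m) fun k =>
      hlim.eventually_const_lt (sub_lt_self L (by positivity))
  have hex : ∀ k, ∃ f ∈ S (N k), J f < L + (1 / 16) ^ k := by
    intro k
    have : I (N k) < L + (1 / 16) ^ k := (hIL _).trans_lt (lt_add_of_pos_right L (by positivity))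
    obtain ⟨_, ⟨f, hf, rfl⟩, hlt⟩ :=
      (csInf_lt_iff (hbdd (N k)) ⟨_, mem_image_of_mem _ (hSne _)⟩).1 this
    exact ⟨f, hf, hlt⟩
  choose v hvS hvJ using hex
  refine ⟨v, fun k => hSanti (hNmono.id_le k) (hvS k), fun k => ?_⟩
  have hk1 : v (k + 1) ∈ S (N k) := hSanti (hNmono.monotone k.le_succ) (hvS (k + 1))
  have hmid : (1 / 2 : ℝ) • v k + (1 / 2 : ℝ) • v (k + 1) ∈ S (N k) :=
    convex_convexHull ℝ _ (hvS k) hk1 (by norm_num) (by norm_num) (by norm_num)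
  have i1 := integrable_sqrt_one_add_sq (hSi _ _ (hvS k)).1
  have i2 := integrable_sqrt_one_add_sq (hSi _ _ hk1).1
  have i3 := integrable_sqrt_one_add_sq (hSi _ _ hmid).1
  simp only [Pi.add_apply, Pi.smul_apply, smul_eq_mul] at i3
  have i4 := ((i1.add i2).sub (i3.const_mul 2)).const_mul 4
  calc _ ≤ ∫⁻ x, ENNReal.ofReal (4 * (√(1 + v k x ^ 2) + √(1 + v (k + 1) x ^ 2)
          - 2 * √(1 + (1 / 2 * v k x + 1 / 2 * v (k + 1) x) ^ 2))) ∂ν :=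
        lintegral_mono fun x => ENNReal.ofReal_le_ofReal (sq_sub_div_sqrt_le _ _)
    _ = ENNReal.ofReal (∫ x, 4 * (√(1 + v k x ^ 2) + √(1 + v (k + 1) x ^ 2)
          - 2 * √(1 + (1 / 2 * v k x + 1 / 2 * v (k + 1) x) ^ 2)) ∂ν) :=
        (ofReal_integral_eq_lintegral_ofReal i4 (Eventually.of_forall fun x =>
          (sq_nonneg _).trans (sq_sub_div_sqrt_le _ _))).symm
    _ ≤ _ := by
        refine ENNReal.ofReal_le_ofReal ?_
        rw [integral_const_mul, integral_sub (by exact i1.add i2) (i3.const_mul 2),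
          integral_add i1 i2, integral_const_mul]
        have e1 := hvJ k
        have e2 := hvJ (k + 1)
        have e3 := hIle _ _ hmid
        have e4 := hN k
        simp only [hJ, Pi.add_apply, Pi.smul_apply, smul_eq_mul] at e1 e2 e3
        have e5 : (1 / 16 : ℝ) ^ (k + 1) ≤ (1 / 16) ^ k :=
          pow_le_pow_of_le_one (by norm_num) (by norm_num) k.le_succ
        linarith

/-- A sequence bounded in `L¹` of a finite measure has convex combinations of its tails that
converge almost everywhere. -/
theorem exists_convexCombo_tendsto_ae [IsFiniteMeasure ν] {u : ℕ → α → ℝ} {C : ℝ}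
    (hu : ∀ k, Integrable (u k) ν) (hC : ∀ k, ∫ x, |u k x| ∂ν ≤ C) :
    ∃ (v : ℕ → α → ℝ) (w : α → ℝ), (∀ k, v k ∈ convexHull ℝ (u '' Ici k)) ∧ Measurable w ∧
      ∀ᵐ x ∂ν, Tendsto (fun k => v k x) atTop (𝓝 (w x)) := by
  obtain ⟨v, hv, hinc⟩ := exists_convexCombo_increments hu hC
  have hvi : ∀ k, Integrable (v k) ν ∧ ∫ x, |v k x| ∂ν ≤ C := fun k =>
    convexHull_min (by rintro _ ⟨i, -, rfl⟩; exact ⟨hu i, hC i⟩) (convex_integral_abs_le C) (hv k)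
  have hvm : ∀ k, AEMeasurable (v k) ν := fun k => (hvi k).1.aemeasurable
  set θ : ℕ → α → ℝ := fun k x => v k x / √(1 + v k x ^ 2) with hθ
  have hθm : ∀ k, AEMeasurable (θ k) ν := fun k => by
    have hc : Measurable fun t : ℝ => t / √(1 + t ^ 2) := by fun_prop
    exact hc.comp_aemeasurable (hvm k)
  have hsum : ∀ᵐ x ∂ν, ∑' k, ENNReal.ofReal (4 ^ k * (θ k x - θ (k + 1) x) ^ 2) < ∞ := by
    have hm : ∀ k, AEMeasurable
        (fun x => ENNReal.ofReal (4 ^ k * (θ k x - θ (k + 1) x) ^ 2)) ν := fun k =>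
      ((((hθm k).sub (hθm (k + 1))).pow_const 2).const_mul _).ennreal_ofReal
    refine ae_lt_top' (AEMeasurable.tsum hm) ?_
    rw [lintegral_tsum hm]
    refine ne_top_of_le_ne_top (b := ∑' k : ℕ, ENNReal.ofReal (16 * (1 / 4) ^ k)) ?_ ?_
    · rw [← ENNReal.ofReal_tsum_of_nonneg (fun k => by positivity)
        ((summable_geometric_of_lt_one (by norm_num) (by norm_num)).mul_left _)]
      exact ENNReal.ofReal_ne_top
    · refine ENNReal.tsum_le_tsum fun k => ?_
      calc _ = ENNReal.ofReal (4 ^ k)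
            * ∫⁻ x, ENNReal.ofReal ((θ k x - θ (k + 1) x) ^ 2) ∂ν := by
            rw [← lintegral_const_mul' _ _ ENNReal.ofReal_ne_top]
            exact lintegral_congr fun x => ENNReal.ofReal_mul (by positivity)
        _ ≤ ENNReal.ofReal (4 ^ k) * ENNReal.ofReal (16 * (1 / 16) ^ k) := by
            gcongr; exact hinc k
        _ = ENNReal.ofReal (16 * (1 / 4) ^ k) := by
            rw [← ENNReal.ofReal_mul (by positivity)]
            congr 1
            rw [mul_left_comm, ← mul_pow]; norm_num
  have hliminf : ∀ᵐ x ∂ν, liminf (fun k => ENNReal.ofReal |v k x|) atTop < ∞ := by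
    have hm : AEMeasurable (fun x => liminf (fun k => ENNReal.ofReal |v k x|) atTop) ν := by
      simp only [liminf_eq_iSup_iInf_of_nat]
      exact AEMeasurable.iSup fun n => AEMeasurable.biInf _ (to_countable _)
        fun k _ => (hvm k).abs.ennreal_ofReal
    refine ae_lt_top' hm ?_
    refine ne_top_of_le_ne_top (b := ENNReal.ofReal C) ENNReal.ofReal_ne_top ?_
    refine (lintegral_liminf_le' fun k => (hvm k).abs.ennreal_ofReal).trans ?_
    refine liminf_le_of_le (by isBoundedDefault) fun b hb => ?_
    obtain ⟨k, hk⟩ := hb.exists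
    refine hk.trans ?_
    rw [← ofReal_integral_eq_lintegral_ofReal (hvi k).1.abs
      (Eventually.of_forall fun x => abs_nonneg _)]
    exact ENNReal.ofReal_le_ofReal (hvi k).2
  have hlim : ∀ᵐ x ∂ν, ∃ l, Tendsto (fun k => v k x) atTop (𝓝 l) := by
    filter_upwards [hsum, hliminf] with x hx hl
    have hT : ∀ k, dist (θ k x) (θ (k + 1) x) ≤
        √(∑' k, ENNReal.ofReal (4 ^ k * (θ k x - θ (k + 1) x) ^ 2)).toReal * (1 / 2) ^ k := by
      intro k
      have h1 := ENNReal.le_tsum (f := fun k => ENNReal.ofReal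
        (4 ^ k * (θ k x - θ (k + 1) x) ^ 2)) k
      rw [ENNReal.ofReal_le_iff_le_toReal hx.ne] at h1
      have h2 := Real.sqrt_le_sqrt h1
      rw [show (4 : ℝ) ^ k * (θ k x - θ (k + 1) x) ^ 2 = (2 ^ k * (θ k x - θ (k + 1) x)) ^ 2 by
        rw [mul_pow, ← pow_mul, mul_comm k, pow_mul]; norm_num,
        Real.sqrt_sq_eq_abs, abs_mul, abs_of_pos (by positivity : (0 : ℝ) < 2 ^ k)] at h2
      rw [Real.dist_eq, one_div, inv_pow, ← div_eq_mul_inv, le_div_iff₀ (by positivity)]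
      linarith
    obtain ⟨τ, hτ⟩ := cauchySeq_tendsto_of_complete
      (cauchySeq_of_le_geometric (1 / 2) _ (by norm_num) hT)
    obtain ⟨M, hM1, hM2⟩ := exists_between hl
    refine exists_tendsto_of_tendsto_div_sqrt (M := M.toReal) hτ ?_
    refine (frequently_lt_of_liminf_lt (by isBoundedDefault) hM1).mono fun k hk => ?_
    exact (ENNReal.ofReal_le_iff_le_toReal hM2.ne).1 hk.le
  obtain ⟨w, hwm, hw⟩ := measurable_limit_of_tendsto_metrizable_ae hvm hlim
  exact ⟨v, w, hv, hwm, hw⟩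

end ConvexCombinations

variable {n : ℕ} {s : ℝ} {G : ℝ → ℝ} {Ω : Set (EuclideanSpace ℝ (Fin n))}

section Measurability

theorem aemeasurable_holderQuotient {u : EuclideanSpace ℝ (Fin n) → ℝ}
    (hu : AEMeasurable u volume) :
    AEMeasurable (fun z : EuclideanSpace ℝ (Fin n) × EuclideanSpace ℝ (Fin n) =>
      holderQuotient s u z.1 z.2) volume := by
  have h1 : AEMeasurable (fun z : EuclideanSpace ℝ (Fin n) × EuclideanSpace ℝ (Fin n) => u z.1)
      volume := hu.comp_quasiMeasurePreserving Measure.quasiMeasurePreserving_fst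
  have h2 : AEMeasurable (fun z : EuclideanSpace ℝ (Fin n) × EuclideanSpace ℝ (Fin n) => u z.2)
      volume := hu.comp_quasiMeasurePreserving Measure.quasiMeasurePreserving_snd
  exact (h1.sub h2).div (by fun_prop)

theorem IsDoublingYoung.aemeasurable_comp (hG : IsDoublingYoung G) {α : Type*}
    [MeasurableSpace α] {ν : Measure α} {f : α → ℝ} (hf : AEMeasurable f ν) :
    AEMeasurable (fun x => G |f x|) ν := hG.continuous.measurable.comp_aemeasurable hf

theorem IsDoublingYoung.aemeasurable_kernel (hG : IsDoublingYoung G)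
    {u : EuclideanSpace ℝ (Fin n) → ℝ} (hu : AEMeasurable u volume) :
    AEMeasurable (fun z : EuclideanSpace ℝ (Fin n) × EuclideanSpace ℝ (Fin n) =>
      ENNReal.ofReal (G |holderQuotient s u z.1 z.2| / ‖z.1 - z.2‖ ^ n)) volume :=
  ((hG.aemeasurable_comp (aemeasurable_holderQuotient hu)).div (by fun_prop)).ennreal_ofReal

theorem IsDoublingYoung.lintegral_lintegral_le_fracModularStar (hG : IsDoublingYoung G)
    {u : EuclideanSpace ℝ (Fin n) → ℝ} (hu : AEMeasurable u volume) :
    ∫⁻ x in Ω, ∫⁻ y, ENNReal.ofReal (G |holderQuotient s u x y| / ‖x - y‖ ^ n)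
      ≤ fracModularStar s G Ω u := by
  have h := hG.aemeasurable_kernel (s := s) hu
  have hprod : (volume.restrict Ω).prod (volume : Measure (EuclideanSpace ℝ (Fin n)))
      = (volume : Measure (EuclideanSpace ℝ (Fin n) × EuclideanSpace ℝ (Fin n))).restrict
        (Ω ×ˢ univ) := by
    rw [Measure.volume_eq_prod, ← Measure.prod_restrict, Measure.restrict_univ]
  rw [← lintegral_prod (fun z : EuclideanSpace ℝ (Fin n) × EuclideanSpace ℝ (Fin n) =>
    ENNReal.ofReal (G |holderQuotient s u z.1 z.2| / ‖z.1 - z.2‖ ^ n))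
    (by rw [hprod]; exact h.restrict), hprod]
  exact lintegral_mono_set fun z hz hz' => hz'.1 hz.1

end Measurability

section WeightedBound

/-- The finite measure on `ℝⁿ` with density `(1 + |y|)^(-(2n + 2))`. -/
noncomputable def decayMeasure (n : ℕ) : Measure (EuclideanSpace ℝ (Fin n)) :=
  volume.withDensity fun y => ENNReal.ofReal ((1 + ‖y‖) ^ (2 * n + 2))⁻¹

theorem lintegral_inv_one_add_norm_pow_lt_top {k : ℕ} (hk : n < k) :
    ∫⁻ y : EuclideanSpace ℝ (Fin n), ENNReal.ofReal ((1 + ‖y‖) ^ k)⁻¹ < ∞ := by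
  have := finite_integral_one_add_norm (E := EuclideanSpace ℝ (Fin n)) (μ := volume) (r := k)
    (by simpa using hk)
  refine lt_of_eq_of_lt (lintegral_congr fun y => ?_) this
  rw [Real.rpow_neg (by positivity), Real.rpow_natCast]

instance isFiniteMeasure_decayMeasure : IsFiniteMeasure (decayMeasure n) :=
  isFiniteMeasure_withDensity (lintegral_inv_one_add_norm_pow_lt_top (by omega)).ne

theorem volume_absolutelyContinuous_decayMeasure :
    (volume : Measure (EuclideanSpace ℝ (Fin n))) ≪ decayMeasure n := by
  refine withDensity_absolutelyContinuous' (by fun_prop) (Eventually.of_forall fun y => ?_)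
  rw [ne_eq, ENNReal.ofReal_eq_zero, not_le]
  positivity

theorem decayMeasure_absolutelyContinuous_volume :
    decayMeasure n ≪ (volume : Measure (EuclideanSpace ℝ (Fin n))) :=
  withDensity_absolutelyContinuous _ _

theorem lintegral_decayMeasure {u : EuclideanSpace ℝ (Fin n) → ℝ≥0∞}
    (hu : AEMeasurable u volume) :
    ∫⁻ y, u y ∂decayMeasure n = ∫⁻ y, ENNReal.ofReal ((1 + ‖y‖) ^ (2 * n + 2))⁻¹ * u y := by
  rw [decayMeasure, lintegral_withDensity_eq_lintegral_mul₀ (by fun_prop) hu]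
  rfl

theorem IsDoublingYoung.weighted_abs_le (hG : IsDoublingYoung G) (hs : s ∈ Ioo (0 : ℝ) 1)
    {R : ℝ} (hR : 1 ≤ R) {x y : EuclideanSpace ℝ (Fin n)} (hx : ‖x‖ ≤ R)
    (u : EuclideanSpace ℝ (Fin n) → ℝ) :
    ((1 + ‖y‖) ^ (2 * n + 2))⁻¹ * |u y| ≤ R ^ (n + 1) * (2 * ((1 + ‖y‖) ^ (n + 1))⁻¹
      + (G 1)⁻¹ * (((1 + ‖y‖) ^ (n + 1))⁻¹ * G |u x|)
      + (G 1)⁻¹ * (G |holderQuotient s u x y| / ‖x - y‖ ^ n)) := by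
  have h1 := hG.pos 1 one_pos
  set κ := G |holderQuotient s u x y| / ‖x - y‖ ^ n with hκ
  have hκ0 : 0 ≤ κ := div_nonneg (hG.nonneg _) (by positivity)
  set p := (1 + ‖y‖) ^ (n + 1) with hp
  have hp1 : 1 ≤ p := one_le_pow₀ (by linarith [norm_nonneg y])
  have hp0 : 0 < p := by positivity
  have hRn : 1 ≤ R ^ (n + 1) := one_le_pow₀ hR
  have hux := hG.abs_le_one_add (u x)
  have hgx := hG.nonneg (u x)
  have hpp : (1 + ‖y‖) ^ (2 * n + 2) = p * p := by rw [hp]; ring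
  set a := G |u x| / G 1 with ha
  have ha0 : 0 ≤ a := by positivity
  have key : |u y| ≤ (R ^ (n + 1) * p) * (2 + a + κ / G 1) := by
    rcases eq_or_ne x y with rfl | hxy
    · have : 1 ≤ R ^ (n + 1) * p := one_le_mul_of_one_le_of_one_le hRn hp1
      have : 0 ≤ κ / G 1 := by positivity
      nlinarith
    set r := ‖x - y‖ with hr
    have hr0 : 0 < r := norm_pos_iff.2 (sub_ne_zero.2 hxy)
    set ρ := R * (1 + ‖y‖) with hρ
    have hρ1 : 1 ≤ ρ := one_le_mul_of_one_le_of_one_le hR (by linarith [norm_nonneg y])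
    have hrρ : r ≤ ρ := by
      have := norm_sub_le x y
      nlinarith [norm_nonneg y]
    have hρn : R ^ (n + 1) * p = ρ ^ n * ρ := by
      rw [hρ, hp, mul_pow]; ring
    set D := holderQuotient s u x y with hD
    have hrs0 : 0 < r ^ s := Real.rpow_pos_of_pos hr0 s
    have hrs : r ^ s ≤ ρ := by
      calc r ^ s ≤ ρ ^ s := Real.rpow_le_rpow hr0.le hrρ hs.1.le
        _ ≤ ρ ^ (1 : ℝ) := Real.rpow_le_rpow_of_exponent_le hρ1 hs.2.le
        _ = ρ := Real.rpow_one _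
    have hdiff : |u x - u y| = |D| * r ^ s := by
      rw [hD, holderQuotient, abs_div, abs_of_pos hrs0, div_mul_cancel₀ _ hrs0.ne']
    have hGD : G |D| = r ^ n * κ := by rw [hκ]; field_simp
    have hDle : |D| ≤ 1 + ρ ^ n * (κ / G 1) := by
      refine (hG.abs_le_one_add D).trans ?_
      rw [hGD, mul_div_assoc]
      gcongr
    have hρn1 : 1 ≤ ρ ^ n := one_le_pow₀ hρ1
    have htri : |u y| ≤ |u x| + |D| * r ^ s := by
      rw [← hdiff]
      have := abs_sub_abs_le_abs_sub (u y) (u x)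
      rw [abs_sub_comm] at this
      linarith
    have hkG : 0 ≤ κ / G 1 := by positivity
    have h3 : |D| * r ^ s ≤ (1 + ρ ^ n * (κ / G 1)) * ρ := by gcongr
    rw [hρn]
    have h4 : 1 ≤ ρ ^ n * ρ := one_le_mul_of_one_le_of_one_le hρn1 hρ1
    have h5 : ρ ≤ ρ ^ n * ρ := le_mul_of_one_le_left (by linarith) hρn1
    nlinarith
  rw [hpp]
  calc (p * p)⁻¹ * |u y| ≤ (p * p)⁻¹ * ((R ^ (n + 1) * p) * (2 + a + κ / G 1)) := by gcongr
    _ = R ^ (n + 1) * (p⁻¹ * (2 + a) + p⁻¹ * (κ / G 1)) := by field_simp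
    _ ≤ R ^ (n + 1) * (p⁻¹ * (2 + a) + 1 * (κ / G 1)) := by
        gcongr; exact inv_le_one_of_one_le₀ hp1
    _ = _ := by rw [ha]; field_simp

/-- Functions with bounded modular on `Ω` and bounded `Φ_{s,G,*}` are bounded in a weighted `L¹`
space over all of `ℝⁿ`. -/
theorem IsDoublingYoung.exists_lintegral_decayMeasure_le (hG : IsDoublingYoung G)
    (hs : s ∈ Ioo (0 : ℝ) 1) (hΩo : IsOpen Ω) (hΩb : Bornology.IsBounded Ω) (hΩne : Ω.Nonempty)
    {M : ℝ≥0∞} (hM : M ≠ ∞) :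
    ∃ C : ℝ≥0∞, C ≠ ∞ ∧ ∀ u : EuclideanSpace ℝ (Fin n) → ℝ, AEMeasurable u volume →
      modular G Ω u ≤ M → fracModularStar s G Ω u ≤ M →
      ∫⁻ y, ENNReal.ofReal |u y| ∂decayMeasure n ≤ C := by
  obtain ⟨R, hR1, hR⟩ : ∃ R : ℝ, 1 ≤ R ∧ ∀ x ∈ Ω, ‖x‖ ≤ R := by
    obtain ⟨R, hR⟩ := hΩb.exists_norm_le
    exact ⟨max 1 R, le_max_left _ _, fun x hx => (hR x hx).trans (le_max_right _ _)⟩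
  have h1 := hG.pos 1 one_pos
  set V := volume Ω with hV
  have hVtop : V ≠ ∞ := hΩb.measure_lt_top.ne
  have hV0 : V ≠ 0 := (hΩo.measure_pos volume hΩne).ne'
  set q : EuclideanSpace ℝ (Fin n) → ℝ := fun y => ((1 + ‖y‖) ^ (n + 1))⁻¹ with hq
  have hq0 : ∀ y, 0 ≤ q y := fun y => by positivity
  have hqm : Measurable fun y => ENNReal.ofReal (q y) := by fun_prop
  set Q := ∫⁻ y, ENNReal.ofReal (q y) with hQ
  have hQtop : Q ≠ ∞ := (lintegral_inv_one_add_norm_pow_lt_top (n := n) (by omega)).ne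
  set c := ENNReal.ofReal (R ^ (n + 1)) with hc
  set d := ENNReal.ofReal (G 1)⁻¹ with hd
  refine ⟨V⁻¹ * (c * (2 * Q * V + d * (Q * M) + d * M)), ?_, fun u hu hmod hfrac => ?_⟩
  · refine ENNReal.mul_ne_top (ENNReal.inv_ne_top.2 hV0) ?_
    simp [ENNReal.mul_eq_top, hQtop, hVtop, hM, hc, hd]
  rw [lintegral_decayMeasure hu.abs.ennreal_ofReal]
  set T := ∫⁻ y, ENNReal.ofReal ((1 + ‖y‖) ^ (2 * n + 2))⁻¹ * ENNReal.ofReal |u y| with hT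
  suffices h : T * V ≤ c * (2 * Q * V + d * (Q * M) + d * M) by
    calc T = V⁻¹ * (T * V) := by
          rw [mul_comm T, ← mul_assoc, ENNReal.inv_mul_cancel hV0 hVtop, one_mul]
      _ ≤ _ := by gcongr
  have hgm : AEMeasurable (fun x => ENNReal.ofReal (G |u x|)) volume :=
    (hG.aemeasurable_comp hu).ennreal_ofReal
  calc T * V = ∫⁻ x in Ω, T := by rw [lintegral_const, Measure.restrict_apply_univ]
    _ ≤ ∫⁻ x in Ω, c * (2 * Q + d * (Q * ENNReal.ofReal (G |u x|))
        + d * ∫⁻ y, ENNReal.ofReal (G |holderQuotient s u x y| / ‖x - y‖ ^ n)) := by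
        refine setLIntegral_mono' hΩo.measurableSet fun x hx => ?_
        calc T ≤ ∫⁻ y, c * (2 * ENNReal.ofReal (q y)
              + d * (ENNReal.ofReal (q y) * ENNReal.ofReal (G |u x|))
              + d * ENNReal.ofReal (G |holderQuotient s u x y| / ‖x - y‖ ^ n)) := by
              refine lintegral_mono fun y => ?_
              have hk : 0 ≤ G |holderQuotient s u x y| / ‖x - y‖ ^ n :=
                div_nonneg (hG.nonneg _) (by positivity)
              have hgx := hG.nonneg (u x)
              have hqy := hq0 y
              have := ENNReal.ofReal_le_ofReal (hG.weighted_abs_le hs hR1 (hR x hx) (y := y) u)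
              rw [ENNReal.ofReal_mul (by positivity), ENNReal.ofReal_mul (by positivity),
                ENNReal.ofReal_add (by positivity) (by positivity),
                ENNReal.ofReal_add (by positivity) (by positivity),
                ENNReal.ofReal_mul (by positivity), ENNReal.ofReal_mul (by positivity),
                ENNReal.ofReal_mul (by positivity), ENNReal.ofReal_mul (by positivity),
                ENNReal.ofReal_ofNat] at this
              exact this
          _ = _ := by
              rw [lintegral_const_mul' _ _ ENNReal.ofReal_ne_top, lintegral_add_left
                (by fun_prop), lintegral_add_left (by fun_prop), lintegral_const_mul _ hqm,
                lintegral_const_mul' _ _ ENNReal.ofReal_ne_top,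
                lintegral_const_mul' _ _ ENNReal.ofReal_ne_top,
                lintegral_mul_const _ hqm]
    _ ≤ _ := by
        rw [lintegral_const_mul' _ _ ENNReal.ofReal_ne_top,
          lintegral_add_left' (by
            exact aemeasurable_const.add ((hgm.restrict.const_mul _).const_mul _)),
          lintegral_add_left' (by exact aemeasurable_const), lintegral_const, Measure.restrict_apply_univ,
          lintegral_const_mul' _ _ ENNReal.ofReal_ne_top, lintegral_const_mul' _ _ hQtop,
          lintegral_const_mul' _ _ ENNReal.ofReal_ne_top]
        gcongr
        · exact hmod
        · exact (hG.lintegral_lintegral_le_fracModularStar hu).trans hfrac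

end WeightedBound

section DyadicCubes

/-- The index of the dyadic cube of side `2⁻ʲ` containing `x`. -/
noncomputable def cubeIndex (j : ℕ) (x : EuclideanSpace ℝ (Fin n)) : Fin n → ℤ := fun i => ⌊2 ^ j * x i⌋

/-- The dyadic cube of side `2⁻ʲ` with index `m`. -/
noncomputable def dyadicCube (j : ℕ) (m : Fin n → ℤ) : Set (EuclideanSpace ℝ (Fin n)) := cubeIndex j ⁻¹' {m}

theorem measurable_cubeIndex (j : ℕ) :
    Measurable (cubeIndex j : EuclideanSpace ℝ (Fin n) → Fin n → ℤ) := by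
  refine measurable_pi_lambda _ fun i => Int.measurable_floor.comp ?_
  fun_prop

theorem measurableSet_dyadicCube (j : ℕ) (m : Fin n → ℤ) : MeasurableSet (dyadicCube j m) :=
  measurable_cubeIndex j (measurableSet_singleton m)

theorem volume_dyadicCube (j : ℕ) (m : Fin n → ℤ) :
    volume (dyadicCube j m) = ENNReal.ofReal (((1 / 2) ^ j) ^ n) := by
  have h : dyadicCube j m = WithLp.ofLp ⁻¹'
      (univ.pi fun i => Ico ((m i : ℝ) / 2 ^ j) (((m i : ℝ) + 1) / 2 ^ j)) := by
    ext x
    simp only [dyadicCube, mem_preimage, mem_singleton_iff, funext_iff, cubeIndex, Int.floor_eq_iff,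
      mem_univ_pi, mem_Ico]
    refine forall_congr' fun i => ?_
    rw [div_le_iff₀' (by positivity), lt_div_iff₀' (by positivity)]
  rw [h, (PiLp.volume_preserving_ofLp (Fin n)).measure_preimage
    (MeasurableSet.univ_pi fun i => measurableSet_Ico).nullMeasurableSet, volume_pi_pi]
  have : ∀ i, volume (Ico ((m i : ℝ) / 2 ^ j) (((m i : ℝ) + 1) / 2 ^ j))
      = ENNReal.ofReal ((1 / 2) ^ j) := fun i => by
    rw [Real.volume_Ico, ← sub_div, add_sub_cancel_left, one_div_pow]
  simp only [this, Finset.prod_const, Finset.card_univ, Fintype.card_fin]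
  rw [ENNReal.ofReal_pow (by positivity) n]

theorem norm_sub_le_of_cubeIndex_eq {j : ℕ} {x y : EuclideanSpace ℝ (Fin n)}
    (h : cubeIndex j x = cubeIndex j y) : ‖x - y‖ ≤ √n * (1 / 2) ^ j := by
  rw [EuclideanSpace.norm_eq]
  refine Real.sqrt_le_iff.2 ⟨by positivity, ?_⟩
  rw [mul_pow, Real.sq_sqrt (by positivity)]
  calc ∑ i, ‖(x - y) i‖ ^ 2 ≤ ∑ _i : Fin n, ((1 / 2 : ℝ) ^ j) ^ 2 := by
        refine Finset.sum_le_sum fun i _ => ?_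
        have h1 := Int.abs_sub_lt_one_of_floor_eq_floor (congrFun h i)
        rw [← mul_sub, abs_mul, abs_of_pos (by positivity : (0 : ℝ) < 2 ^ j)] at h1
        have h2 : |x i - y i| ≤ (1 / 2) ^ j := by
          rw [one_div_pow, le_div_iff₀ (by positivity)]; linarith
        rw [PiLp.sub_apply, Real.norm_eq_abs]
        gcongr
    _ = _ := by simp

theorem finite_cubeIndex_image (j : ℕ) (hΩb : Bornology.IsBounded Ω) :
    (cubeIndex j '' Ω).Finite := by
  obtain ⟨R, hR⟩ := hΩb.exists_norm_le
  refine (Set.finite_Icc (fun _ : Fin n => ⌊-(2 ^ j * R)⌋) fun _ => ⌊2 ^ j * R⌋).subset ?_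
  rintro _ ⟨x, hx, rfl⟩
  have h : ∀ i, |x i| ≤ R := fun i => (PiLp.norm_apply_le x i).trans (hR x hx)
  constructor
  · intro i
    refine Int.floor_le_floor ?_
    rw [← mul_neg]
    exact mul_le_mul_of_nonneg_left (abs_le.1 (h i)).1 (by positivity)
  · intro i
    exact Int.floor_le_floor (mul_le_mul_of_nonneg_left (abs_le.1 (h i)).2 (by positivity))

theorem exists_norm_le_of_mem_dyadicCube (j : ℕ) (m : Fin n → ℤ) :
    ∃ R : ℝ, 0 ≤ R ∧ ∀ x ∈ dyadicCube j m, ‖x‖ ≤ R := by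
  by_cases h : (dyadicCube j m).Nonempty
  · obtain ⟨y, hy⟩ := h
    refine ⟨‖y‖ + √n * (1 / 2) ^ j, by positivity, fun x hx => ?_⟩
    have h1 := norm_sub_le_of_cubeIndex_eq (j := j) (x := x) (y := y)
      ((show cubeIndex j x = m from hx).trans (show cubeIndex j y = m from hy).symm)
    have h2 := norm_add_le y (x - y)
    rw [add_sub_cancel] at h2
    linarith
  · exact ⟨0, le_rfl, fun x hx => absurd ⟨x, hx⟩ h⟩

end DyadicCubes

section Averages

theorem IsDoublingYoung.jensen (hG : IsDoublingYoung G) {α : Type*} [MeasurableSpace α]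
    {ν : Measure α} {Q : Set α} (hQ0 : ν Q ≠ 0) (hQ : ν Q ≠ ∞) {f : α → ℝ}
    (hf : IntegrableOn f Q ν) (a : ℝ) :
    ENNReal.ofReal (G |a - ⨍ y in Q, f y ∂ν|)
      ≤ (ν Q)⁻¹ * ∫⁻ y in Q, ENNReal.ofReal (G |a - f y|) ∂ν := by
  have : IsFiniteMeasure (ν.restrict Q) := ⟨by simpa using hQ.lt_top⟩
  have : NeZero (ν.restrict Q) := ⟨by simpa using hQ0⟩
  by_cases htop : ∫⁻ y in Q, ENNReal.ofReal (G |a - f y|) ∂ν = ∞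
  · rw [htop, ENNReal.mul_top (ENNReal.inv_ne_zero.2 hQ)]; exact le_top
  have hfa : Integrable (fun y => a - f y) (ν.restrict Q) := (integrable_const a).sub hf
  have hm : AEStronglyMeasurable (fun y => G |a - f y|) (ν.restrict Q) :=
    hG.continuous.comp_aestronglyMeasurable hfa.1
  have hi : Integrable (fun y => G |a - f y|) (ν.restrict Q) :=
    (lintegral_ofReal_ne_top_iff_integrable hm
      (Eventually.of_forall fun y => hG.nonneg _)).1 htop
  have h := hG.convex.map_average_le (μ := ν.restrict Q) (f := fun y => a - f y)
    hG.continuous.continuousOn isClosed_univ (Eventually.of_forall fun y => mem_univ _) hfa hi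
  have hav : ⨍ y in Q, (a - f y) ∂ν = a - ⨍ y in Q, f y ∂ν := by
    have hr : ν.real Q ≠ 0 := (ENNReal.toReal_pos hQ0 hQ).ne'
    rw [setAverage_eq, setAverage_eq, integral_sub (integrable_const a) hf]
    simp only [integral_const, measureReal_restrict_apply_univ, smul_eq_mul]
    field_simp
  rw [hav] at h
  refine (ENNReal.ofReal_le_ofReal h).trans (le_of_eq ?_)
  rw [setAverage_eq, smul_eq_mul, ENNReal.ofReal_mul (by positivity),
    ofReal_integral_eq_lintegral_ofReal hi (Eventually.of_forall fun y => hG.nonneg _),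
    measureReal_def, ← ENNReal.toReal_inv, ENNReal.ofReal_toReal (ENNReal.inv_ne_top.2 hQ0)]

/-- The average of `u` over the dyadic cube of side `2⁻ʲ` containing `x`. -/
noncomputable def cubeAverage (j : ℕ) (u : EuclideanSpace ℝ (Fin n) → ℝ)
    (x : EuclideanSpace ℝ (Fin n)) : ℝ := ⨍ y in dyadicCube j (cubeIndex j x), u y

theorem measurable_cubeAverage (j : ℕ) (u : EuclideanSpace ℝ (Fin n) → ℝ) :
    Measurable (cubeAverage j u) :=
  (measurable_of_countable fun m : Fin n → ℤ => ⨍ y in dyadicCube j m, u y).comp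
    (measurable_cubeIndex j)

theorem IsDoublingYoung.map_sub_le (hG : IsDoublingYoung G) (hs : s ∈ Ioo (0 : ℝ) 1)
    {δ : ℝ} (hδ : δ ≤ 1) {x y : EuclideanSpace ℝ (Fin n)} (hxy : ‖x - y‖ ≤ δ)
    (u : EuclideanSpace ℝ (Fin n) → ℝ) :
    G |u x - u y| ≤ δ ^ s * δ ^ n * (G |holderQuotient s u x y| / ‖x - y‖ ^ n) := by
  have hδ0 : 0 ≤ δ := (norm_nonneg _).trans hxy
  rcases eq_or_ne x y with rfl | hne
  · rw [sub_self, abs_zero, hG.zero]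
    have := div_nonneg (hG.nonneg (holderQuotient s u x x)) (by positivity : 0 ≤ ‖x - x‖ ^ n)
    positivity
  set r := ‖x - y‖ with hr
  have hr0 : 0 < r := norm_pos_iff.2 (sub_ne_zero.2 hne)
  have hrs0 : 0 < r ^ s := Real.rpow_pos_of_pos hr0 s
  have hgn := hG.nonneg (holderQuotient s u x y)
  have e : u x - u y = r ^ s * holderQuotient s u x y := by
    rw [holderQuotient, mul_div_cancel₀ _ hrs0.ne']
  rw [e]
  calc G |r ^ s * holderQuotient s u x y| ≤ r ^ s * G |holderQuotient s u x y| :=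
        hG.mul_le hrs0.le (Real.rpow_le_one hr0.le (hxy.trans hδ) hs.1.le) _
    _ = r ^ s * r ^ n * (G |holderQuotient s u x y| / r ^ n) := by field_simp
    _ ≤ _ := by
        gcongr
        exact hs.1.le

/-- The modular distance between `u` and its dyadic averages is controlled by `Φ_{s,G,*}`. -/
theorem IsDoublingYoung.modular_sub_cubeAverage_le (hG : IsDoublingYoung G)
    (hs : s ∈ Ioo (0 : ℝ) 1) {j : ℕ} (hj : √n * (1 / 2) ^ j ≤ 1)
    {u : EuclideanSpace ℝ (Fin n) → ℝ} (hu : AEMeasurable u volume)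
    (hui : ∀ m, IntegrableOn u (dyadicCube j m)) :
    modular G Ω (fun x => u x - cubeAverage j u x)
      ≤ ENNReal.ofReal (√n ^ n * (√n * (1 / 2) ^ j) ^ s) * fracModularStar s G Ω u := by
  set δ := √n * (1 / 2 : ℝ) ^ j with hδ
  set a : ℝ := ((1 / 2 : ℝ) ^ j) ^ n with ha
  have ha0 : 0 < a := by positivity
  have hvol : ∀ m : Fin n → ℤ, volume (dyadicCube j m) = ENNReal.ofReal a := volume_dyadicCube j
  have key : ∀ x, ENNReal.ofReal (G |u x - cubeAverage j u x|) ≤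
      ENNReal.ofReal (√n ^ n * δ ^ s)
        * ∫⁻ y, ENNReal.ofReal (G |holderQuotient s u x y| / ‖x - y‖ ^ n) := by
    intro x
    set Q := dyadicCube j (cubeIndex j x) with hQ
    have hQ0 : volume Q ≠ 0 := by rw [hvol]; simpa using ha0
    have hQt : volume Q ≠ ∞ := by rw [hvol]; exact ENNReal.ofReal_ne_top
    calc ENNReal.ofReal (G |u x - cubeAverage j u x|)
        ≤ (volume Q)⁻¹ * ∫⁻ y in Q, ENNReal.ofReal (G |u x - u y|) :=
          hG.jensen hQ0 hQt (hui _) (u x)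
      _ ≤ (volume Q)⁻¹ * ∫⁻ y in Q, ENNReal.ofReal (δ ^ s * δ ^ n)
            * ENNReal.ofReal (G |holderQuotient s u x y| / ‖x - y‖ ^ n) := by
          refine mul_le_mul_right ?_ _
          refine setLIntegral_mono' (measurableSet_dyadicCube _ _) fun y hy => ?_
          rw [← ENNReal.ofReal_mul (by positivity)]
          exact ENNReal.ofReal_le_ofReal (hG.map_sub_le hs hj
            (norm_sub_le_of_cubeIndex_eq (show cubeIndex j y = cubeIndex j x from hy).symm) u)
      _ ≤ (volume Q)⁻¹ * ∫⁻ y, ENNReal.ofReal (δ ^ s * δ ^ n)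
            * ENNReal.ofReal (G |holderQuotient s u x y| / ‖x - y‖ ^ n) := by
          gcongr; exact Measure.restrict_le_self
      _ = _ := by
          rw [lintegral_const_mul' _ _ ENNReal.ofReal_ne_top, ← mul_assoc, hvol,
            ← ENNReal.ofReal_inv_of_pos ha0, ← ENNReal.ofReal_mul (by positivity)]
          congr 2
          rw [hδ, mul_pow, ← ha]
          field_simp
  calc modular G Ω (fun x => u x - cubeAverage j u x)
      ≤ ∫⁻ x in Ω, ENNReal.ofReal (√n ^ n * δ ^ s)
        * ∫⁻ y, ENNReal.ofReal (G |holderQuotient s u x y| / ‖x - y‖ ^ n) := lintegral_mono key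
    _ ≤ _ := by
        rw [lintegral_const_mul' _ _ ENNReal.ofReal_ne_top]
        gcongr
        exact hG.lintegral_lintegral_le_fracModularStar hu

end Averages

section Compactness

theorem exists_setAverage_bound (j : ℕ) (m : Fin n → ℤ) {C : ℝ≥0∞} (hC : C ≠ ∞) :
    ∃ B : ℝ, ∀ u : EuclideanSpace ℝ (Fin n) → ℝ, AEMeasurable u volume →
      ∫⁻ y, ENNReal.ofReal |u y| ∂decayMeasure n ≤ C →
      IntegrableOn u (dyadicCube j m) ∧ |⨍ y in dyadicCube j m, u y| ≤ B := by
  obtain ⟨R, hR0, hR⟩ := exists_norm_le_of_mem_dyadicCube j m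
  set p := (1 + R) ^ (2 * n + 2) with hp
  have hp0 : 0 < p := by positivity
  refine ⟨(volume.real (dyadicCube j m))⁻¹ * (ENNReal.ofReal p * C).toReal, fun u hu huC => ?_⟩
  rw [lintegral_decayMeasure hu.abs.ennreal_ofReal] at huC
  have hle : ∫⁻ y in dyadicCube j m, ENNReal.ofReal |u y| ≤ ENNReal.ofReal p * C := by
    calc ∫⁻ y in dyadicCube j m, ENNReal.ofReal |u y|
        ≤ ∫⁻ y in dyadicCube j m, ENNReal.ofReal p *
          (ENNReal.ofReal ((1 + ‖y‖) ^ (2 * n + 2))⁻¹ * ENNReal.ofReal |u y|) := by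
          refine setLIntegral_mono' (measurableSet_dyadicCube _ _) fun y hy => ?_
          rw [← mul_assoc, ← ENNReal.ofReal_mul hp0.le]
          refine le_mul_of_one_le_left' ?_
          rw [ENNReal.one_le_ofReal, ← div_eq_mul_inv, one_le_div (by positivity), hp]
          gcongr
          exact hR y hy
      _ ≤ ∫⁻ y, ENNReal.ofReal p *
          (ENNReal.ofReal ((1 + ‖y‖) ^ (2 * n + 2))⁻¹ * ENNReal.ofReal |u y|) :=
          setLIntegral_le_lintegral _ _
      _ ≤ _ := by rw [lintegral_const_mul' _ _ ENNReal.ofReal_ne_top]; gcongr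
  have hpC : ENNReal.ofReal p * C ≠ ∞ := ENNReal.mul_ne_top ENNReal.ofReal_ne_top hC
  have hi : IntegrableOn u (dyadicCube j m) := by
    refine ⟨hu.restrict.aestronglyMeasurable, ?_⟩
    rw [hasFiniteIntegral_iff_norm]
    exact hle.trans_lt hpC.lt_top
  refine ⟨hi, ?_⟩
  rw [setAverage_eq, smul_eq_mul, abs_mul, abs_of_nonneg (by positivity)]
  gcongr
  refine (norm_integral_le_lintegral_norm u).trans ?_
  exact ENNReal.toReal_mono hpC hle

/-- Compactness: bounded sequences have a subsequence that is Cauchy in modular on `Ω`. -/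
theorem IsDoublingYoung.exists_subseq_modular_cauchy (hG : IsDoublingYoung G)
    (hs : s ∈ Ioo (0 : ℝ) 1) (hΩo : IsOpen Ω) (hΩb : Bornology.IsBounded Ω) (hΩne : Ω.Nonempty)
    {M : ℝ≥0∞} (hM : M ≠ ∞) {u : ℕ → EuclideanSpace ℝ (Fin n) → ℝ}
    (hu : ∀ k, AEMeasurable (u k) volume) (hmod : ∀ k, modular G Ω (u k) ≤ M)
    (hfrac : ∀ k, fracModularStar s G Ω (u k) ≤ M) :
    ∃ φ : ℕ → ℕ, StrictMono φ ∧ ∀ ε : ℝ≥0∞, 0 < ε → ∃ N, ∀ k ≥ N, ∀ l ≥ N,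
      modular G Ω (fun x => u (φ k) x - u (φ l) x) ≤ ε := by
  obtain ⟨C, hC, hCu⟩ := hG.exists_lintegral_decayMeasure_le hs hΩo hΩb hΩne hM
  choose B hB using fun p : ℕ × (Fin n → ℤ) => exists_setAverage_bound p.1 p.2 hC
  have hBu := fun p k => hB p (u k) (hu k) (hCu _ (hu k) (hmod k) (hfrac k))
  have hcomp : IsCompact (univ.pi fun p : ℕ × (Fin n → ℤ) => Icc (-B p) (B p)) :=
    isCompact_univ_pi fun p => isCompact_Icc
  obtain ⟨a, -, φ, hφ, hlim⟩ := hcomp.isSeqCompact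
    (x := fun k p => ⨍ y in dyadicCube p.1 p.2, u k y) fun k p _ => abs_le.1 (hBu p k).2
  rw [tendsto_pi_nhds] at hlim
  refine ⟨φ, hφ, ?_⟩
  obtain ⟨K, hK0, hK⟩ := hG.add_le
  have hV : volume Ω ≠ ∞ := hΩb.measure_lt_top.ne
  have hsplit : ∀ j k l, √n * (1 / 2 : ℝ) ^ j ≤ 1 →
      modular G Ω (fun x => u k x - u l x) ≤
      ENNReal.ofReal (K * K) * (ENNReal.ofReal (√n ^ n * (√n * (1 / 2) ^ j) ^ s) * M
        + ENNReal.ofReal (√n ^ n * (√n * (1 / 2) ^ j) ^ s) * M)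
      + ENNReal.ofReal K * modular G Ω (fun x => cubeAverage j (u k) x - cubeAverage j (u l) x) := by
    intro j k l hj
    have e := fun k => (hG.modular_sub_cubeAverage_le (Ω := Ω) hs hj (hu k)
      fun m => (hBu (j, m) k).1).trans (mul_le_mul_right (hfrac k) _)
    have hm : ∀ k, AEMeasurable (fun x => ENNReal.ofReal (G |u k x - cubeAverage j (u k) x|))
        (volume.restrict Ω) := fun k =>
      (hG.aemeasurable_comp ((hu k).sub
        (measurable_cubeAverage j (u k)).aemeasurable)).ennreal_ofReal.restrict
    calc modular G Ω (fun x => u k x - u l x)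
        ≤ ∫⁻ x in Ω, (ENNReal.ofReal (K * K) * (ENNReal.ofReal (G |u k x - cubeAverage j (u k) x|)
          + ENNReal.ofReal (G |u l x - cubeAverage j (u l) x|))
          + ENNReal.ofReal K *
            ENNReal.ofReal (G |cubeAverage j (u k) x - cubeAverage j (u l) x|)) := by
          refine lintegral_mono fun x => ?_
          set p := cubeAverage j (u k) x
          set q := cubeAverage j (u l) x
          have g1 := hG.nonneg (u k x - p)
          have g2 := hG.nonneg (u l x - q)
          have g3 := hG.nonneg (p - q)
          rw [← ENNReal.ofReal_add g1 g2, ← ENNReal.ofReal_mul (by positivity),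
            ← ENNReal.ofReal_mul (by positivity), ← ENNReal.ofReal_add (by positivity)
            (by positivity)]
          refine ENNReal.ofReal_le_ofReal ?_
          have h1 := hK ((u k x - p) + (q - u l x)) (p - q)
          have h2 := hK (u k x - p) (q - u l x)
          rw [abs_sub_comm q] at h2
          rw [show u k x - p + (q - u l x) + (p - q) = u k x - u l x by ring] at h1
          nlinarith
      _ = ENNReal.ofReal (K * K) * (modular G Ω (fun x => u k x - cubeAverage j (u k) x)
          + modular G Ω (fun x => u l x - cubeAverage j (u l) x))
          + ENNReal.ofReal K *
            modular G Ω (fun x => cubeAverage j (u k) x - cubeAverage j (u l) x) := by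
          rw [lintegral_add_left' (by exact ((hm k).add (hm l)).const_mul _),
            lintegral_const_mul' _ _ ENNReal.ofReal_ne_top,
            lintegral_const_mul' _ _ ENNReal.ofReal_ne_top, lintegral_add_left' (hm k)]
          rfl
      _ ≤ _ := by gcongr; exacts [e k, e l]
  intro ε hε
  have hε2 : 0 < ε / 2 := ENNReal.half_pos hε.ne'
  obtain ⟨j, hj1, hj2⟩ : ∃ j : ℕ, √n * (1 / 2 : ℝ) ^ j ≤ 1 ∧
      ENNReal.ofReal (K * K) * (ENNReal.ofReal (√n ^ n * (√n * (1 / 2) ^ j) ^ s) * M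
        + ENNReal.ofReal (√n ^ n * (√n * (1 / 2) ^ j) ^ s) * M) ≤ ε / 2 := by
    have t1 : Tendsto (fun j : ℕ => √n * (1 / 2 : ℝ) ^ j) atTop (𝓝 0) := by
      simpa using (tendsto_pow_atTop_nhds_zero_of_lt_one (r := (1 / 2 : ℝ))
        (by norm_num) (by norm_num)).const_mul (√n)
    have t2 : Tendsto (fun j : ℕ => √n ^ n * (√n * (1 / 2 : ℝ) ^ j) ^ s) atTop (𝓝 0) := by
      have := (t1.rpow_const (p := s) (Or.inr hs.1.le)).const_mul (√n ^ n)
      rwa [Real.zero_rpow hs.1.ne', mul_zero] at this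
    have t3 : Tendsto (fun j : ℕ => ENNReal.ofReal (√n ^ n * (√n * (1 / 2) ^ j) ^ s) * M) atTop
        (𝓝 0) := by
      have := ENNReal.Tendsto.mul_const (ENNReal.tendsto_ofReal t2) (Or.inr hM)
      simpa using this
    have t4 := ENNReal.Tendsto.const_mul (a := ENNReal.ofReal (K * K)) (t3.add t3)
      (Or.inr ENNReal.ofReal_ne_top)
    rw [add_zero, mul_zero] at t4
    exact ((t1.eventually_le_const one_pos).and (t4.eventually_le_const hε2)).exists
  obtain ⟨η, hη0, hη⟩ : ∃ η : ℝ, 0 < η ∧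
      ENNReal.ofReal K * (ENNReal.ofReal (G |η|) * volume Ω) ≤ ε / 2 := by
    have t1 : Tendsto (fun η : ℝ => G |η|) (𝓝[>] 0) (𝓝 0) := by
      have := (hG.continuous.tendsto 0).mono_left (nhdsWithin_le_nhds (s := Ioi 0))
      simpa [hG.zero] using this
    have t2 := ENNReal.Tendsto.const_mul (a := ENNReal.ofReal K)
      (ENNReal.Tendsto.mul_const (b := volume Ω) (ENNReal.tendsto_ofReal t1) (Or.inr hV))
      (Or.inr ENNReal.ofReal_ne_top)
    simp only [ENNReal.ofReal_zero, zero_mul, mul_zero] at t2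
    obtain ⟨η, h1, h2⟩ := ((t2.eventually_le_const hε2).and self_mem_nhdsWithin).exists
    exact ⟨η, h2, h1⟩
  have hev : ∀ᶠ k in atTop, ∀ m ∈ cubeIndex j '' Ω,
      |(⨍ y in dyadicCube j m, u (φ k) y) - a (j, m)| ≤ η / 2 := by
    rw [eventually_all_finite (finite_cubeIndex_image j hΩb)]
    intro m _
    have := Metric.tendsto_nhds.1 (hlim (j, m)) (η / 2) (half_pos hη0)
    filter_upwards [this] with k hk
    exact hk.le
  obtain ⟨N, hN⟩ := eventually_atTop.1 hev
  refine ⟨N, fun k hk l hl => (hsplit j _ _ hj1).trans ?_⟩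
  refine (add_le_add hj2 (le_trans ?_ hη)).trans_eq (ENNReal.add_halves ε)
  gcongr
  rw [← Measure.restrict_apply_univ Ω, ← lintegral_const]
  refine setLIntegral_mono' hΩo.measurableSet fun x hx => ENNReal.ofReal_le_ofReal (hG.mono ?_)
  have h1 := hN k hk _ (mem_image_of_mem _ hx)
  have h2 := hN l hl _ (mem_image_of_mem _ hx)
  rw [abs_of_pos hη0]
  simp only [cubeAverage]
  rw [abs_le] at h1 h2 ⊢
  constructor <;> linarith

end Compactness

section ConvexityAndFatou

variable {α : Type*} [MeasurableSpace α] {ν : Measure α}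

theorem IsDoublingYoung.lintegral_combo_le (hG : IsDoublingYoung G) {c f g : α → ℝ}
    (hc : AEMeasurable c ν) (hc0 : ∀ᵐ x ∂ν, 0 ≤ c x) (hf : AEMeasurable f ν)
    {a b : ℝ} (ha : 0 ≤ a) (hb : 0 ≤ b) (hab : a + b = 1) :
    ∫⁻ x, ENNReal.ofReal (c x * G |a * f x + b * g x|) ∂ν
      ≤ ENNReal.ofReal a * ∫⁻ x, ENNReal.ofReal (c x * G |f x|) ∂ν
        + ENNReal.ofReal b * ∫⁻ x, ENNReal.ofReal (c x * G |g x|) ∂ν := by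
  rw [← lintegral_const_mul' _ _ ENNReal.ofReal_ne_top,
    ← lintegral_const_mul' _ _ ENNReal.ofReal_ne_top,
    ← lintegral_add_left' (by
      exact (hc.mul (hG.aemeasurable_comp hf)).ennreal_ofReal.const_mul _)]
  refine lintegral_mono_ae (hc0.mono fun x hx => ?_)
  have h1 := hG.nonneg (f x)
  have h2 := hG.nonneg (g x)
  rw [← ENNReal.ofReal_mul ha, ← ENNReal.ofReal_mul hb,
    ← ENNReal.ofReal_add (by positivity) (by positivity)]
  refine ENNReal.ofReal_le_ofReal ?_
  calc c x * G |a * f x + b * g x| ≤ c x * (a * G |f x| + b * G |g x|) := by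
        gcongr; exact hG.combo_le ha hb hab _ _
    _ = _ := by ring

theorem IsDoublingYoung.lintegral_le_liminf (hG : IsDoublingYoung G) {c : α → ℝ}
    {f : ℕ → α → ℝ} {g : α → ℝ} (hc : AEMeasurable c ν) (hf : ∀ k, AEMeasurable (f k) ν)
    (hfg : ∀ᵐ x ∂ν, Tendsto (fun k => f k x) atTop (𝓝 (g x))) :
    ∫⁻ x, ENNReal.ofReal (c x * G |g x|) ∂ν
      ≤ liminf (fun k => ∫⁻ x, ENNReal.ofReal (c x * G |f k x|) ∂ν) atTop := by
  refine le_trans (lintegral_mono_ae (hfg.mono fun x hx => ?_)) (lintegral_liminf_le' fun k =>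
    (hc.mul (hG.aemeasurable_comp (hf k))).ennreal_ofReal)
  refine le_of_eq (Tendsto.liminf_eq ?_).symm
  exact ENNReal.tendsto_ofReal (((hG.continuous.tendsto _).comp hx).const_mul _)

end ConvexityAndFatou

section Functionals

theorem holderQuotient_combo (a b : ℝ) (u v : EuclideanSpace ℝ (Fin n) → ℝ)
    (x y : EuclideanSpace ℝ (Fin n)) :
    holderQuotient s (a • u + b • v) x y
      = a * holderQuotient s u x y + b * holderQuotient s v x y := by
  simp only [holderQuotient, Pi.add_apply, Pi.smul_apply, smul_eq_mul]
  ring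

variable {A : Set (EuclideanSpace ℝ (Fin n) × EuclideanSpace ℝ (Fin n))}

theorem IsDoublingYoung.fracModularOn_combo_le (hG : IsDoublingYoung G)
    {u v : EuclideanSpace ℝ (Fin n) → ℝ} (hu : AEMeasurable u volume)
    {a b : ℝ} (ha : 0 ≤ a) (hb : 0 ≤ b) (hab : a + b = 1) :
    fracModularOn s G A (a • u + b • v)
      ≤ ENNReal.ofReal a * fracModularOn s G A u + ENNReal.ofReal b * fracModularOn s G A v := by
  simp only [fracModularOn, holderQuotient_combo, div_eq_inv_mul]
  exact hG.lintegral_combo_le (c := fun z : EuclideanSpace ℝ (Fin n) × EuclideanSpace ℝ (Fin n) =>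
    (‖z.1 - z.2‖ ^ n)⁻¹) (by fun_prop) (Eventually.of_forall fun z => by positivity)
    (aemeasurable_holderQuotient hu).restrict ha hb hab

theorem IsDoublingYoung.fracModularOn_le_liminf (hG : IsDoublingYoung G)
    {v : ℕ → EuclideanSpace ℝ (Fin n) → ℝ} {w : EuclideanSpace ℝ (Fin n) → ℝ}
    (hv : ∀ k, AEMeasurable (v k) volume)
    (hvw : ∀ᵐ x, Tendsto (fun k => v k x) atTop (𝓝 (w x))) :
    fracModularOn s G A w ≤ liminf (fun k => fracModularOn s G A (v k)) atTop := by
  simp only [fracModularOn, div_eq_inv_mul]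
  refine hG.lintegral_le_liminf (c := fun z : EuclideanSpace ℝ (Fin n) × EuclideanSpace ℝ (Fin n) =>
    (‖z.1 - z.2‖ ^ n)⁻¹) (by fun_prop) (fun k => (aemeasurable_holderQuotient (hv k)).restrict)
    (ae_restrict_of_ae ?_)
  filter_upwards [Measure.quasiMeasurePreserving_fst.ae hvw,
    Measure.quasiMeasurePreserving_snd.ae hvw] with z h1 h2
  exact (h1.sub h2).div_const _

variable {β : EuclideanSpace ℝ (Fin n) → ℝ} {B : Set (EuclideanSpace ℝ (Fin n))}

theorem IsDoublingYoung.weightedModular_combo_le (hG : IsDoublingYoung G)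
    (hβ : AEMeasurable β (volume.restrict B)) (hβ0 : ∀ᵐ x ∂volume.restrict B, 0 ≤ β x)
    {u v : EuclideanSpace ℝ (Fin n) → ℝ} (hu : AEMeasurable u volume)
    {a b : ℝ} (ha : 0 ≤ a) (hb : 0 ≤ b) (hab : a + b = 1) :
    weightedModular G β B (a • u + b • v)
      ≤ ENNReal.ofReal a * weightedModular G β B u
        + ENNReal.ofReal b * weightedModular G β B v :=
  hG.lintegral_combo_le hβ hβ0 hu.restrict ha hb hab

theorem IsDoublingYoung.weightedModular_le_liminf (hG : IsDoublingYoung G)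
    (hβ : AEMeasurable β (volume.restrict B))
    {v : ℕ → EuclideanSpace ℝ (Fin n) → ℝ} {w : EuclideanSpace ℝ (Fin n) → ℝ}
    (hv : ∀ k, AEMeasurable (v k) volume)
    (hvw : ∀ᵐ x, Tendsto (fun k => v k x) atTop (𝓝 (w x))) :
    weightedModular G β B w ≤ liminf (fun k => weightedModular G β B (v k)) atTop :=
  hG.lintegral_le_liminf hβ (fun k => (hv k).restrict) (ae_restrict_of_ae hvw)

theorem IsDoublingYoung.convex_modular_sub_le (hG : IsDoublingYoung G)
    {w : EuclideanSpace ℝ (Fin n) → ℝ} (hw : AEMeasurable w volume) (ε : ℝ≥0∞) :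
    Convex ℝ {u | AEMeasurable u volume ∧ modular G Ω (fun x => u x - w x) ≤ ε} := by
  rintro u ⟨hu, hue⟩ v ⟨hv, hve⟩ a b ha hb hab
  refine ⟨(hu.const_smul a).add (hv.const_smul b), ?_⟩
  have h := hG.lintegral_combo_le (ν := volume.restrict Ω) (c := fun _ => 1)
    (f := fun x => u x - w x) (g := fun x => v x - w x) aemeasurable_const
    (Eventually.of_forall fun _ => zero_le_one) (hu.sub hw).restrict ha hb hab
  simp only [one_mul] at h
  have e : ∀ x, a * (u x - w x) + b * (v x - w x) = (a • u + b • v) x - w x := fun x => by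
    simp only [Pi.add_apply, Pi.smul_apply, smul_eq_mul]
    linear_combination (-w x) * hab
  simp only [e] at h
  calc _ ≤ _ := h
    _ ≤ ENNReal.ofReal a * ε + ENNReal.ofReal b * ε := by gcongr <;> assumption
    _ = ε := by rw [← add_mul, ← ENNReal.ofReal_add ha hb, hab, ENNReal.ofReal_one, one_mul]

theorem IsDoublingYoung.modular_le_liminf (hG : IsDoublingYoung G)
    {v : ℕ → EuclideanSpace ℝ (Fin n) → ℝ} {w : EuclideanSpace ℝ (Fin n) → ℝ}
    (hv : ∀ k, AEMeasurable (v k) volume)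
    (hvw : ∀ᵐ x, Tendsto (fun k => v k x) atTop (𝓝 (w x))) :
    modular G Ω w ≤ liminf (fun k => modular G Ω (v k)) atTop := by
  have := hG.lintegral_le_liminf (ν := volume.restrict Ω) (c := fun _ => 1) aemeasurable_const
    (fun k => (hv k).restrict) (ae_restrict_of_ae hvw)
  simp only [one_mul] at this
  exact this

end Functionals

section ModularConvergence

theorem IsDoublingYoung.add_le_one_add (hG : IsDoublingYoung G) {η : ℝ} (hη : 0 < η) :
    ∃ K : ℝ, 0 < K ∧ ∀ x y, G |x + y| ≤ (1 + η) * G |x| + K * G |y| := by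
  obtain ⟨l, hl, h1⟩ := hG.near_one η hη
  obtain ⟨K, hK, h2⟩ := hG.doubling (1 - l⁻¹)⁻¹
  have hl0 : 0 < l := by linarith
  have hl1 : l⁻¹ < 1 := inv_lt_one_of_one_lt₀ hl
  have hl2 : 0 < l⁻¹ := by positivity
  refine ⟨K, hK, fun x y => ?_⟩
  have h3 := hG.combo_le hl2.le (sub_pos.2 hl1).le (add_sub_cancel _ _) (l * x)
    ((1 - l⁻¹)⁻¹ * y)
  rw [inv_mul_cancel_left₀ hl0.ne', mul_inv_cancel_left₀ (sub_pos.2 hl1).ne'] at h3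
  have g1 := hG.nonneg x
  have g2 := hG.nonneg y
  calc G |x + y| ≤ _ := h3
    _ ≤ l⁻¹ * ((1 + η) * G |x|) + (1 - l⁻¹) * (K * G |y|) := by
        gcongr
        · exact h1 x
        · exact h2 y
    _ ≤ 1 * ((1 + η) * G |x|) + 1 * (K * G |y|) := by gcongr; linarith
    _ = _ := by ring

theorem IsDoublingYoung.modular_add_le (hG : IsDoublingYoung G) {η : ℝ} (hη : 0 < η) :
    ∃ K : ℝ, ∀ u v : EuclideanSpace ℝ (Fin n) → ℝ, AEMeasurable u volume →
      modular G Ω (fun x => u x + v x)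
        ≤ ENNReal.ofReal (1 + η) * modular G Ω u + ENNReal.ofReal K * modular G Ω v := by
  obtain ⟨K, hK, h⟩ := hG.add_le_one_add hη
  refine ⟨K, fun u v hu => ?_⟩
  simp only [modular]
  rw [← lintegral_const_mul' _ _ ENNReal.ofReal_ne_top,
    ← lintegral_const_mul' _ _ ENNReal.ofReal_ne_top,
    ← lintegral_add_left' ((hG.aemeasurable_comp hu).ennreal_ofReal.restrict.const_mul _)]
  refine lintegral_mono fun x => ?_
  have g1 := hG.nonneg (u x)
  have g2 := hG.nonneg (v x)
  rw [← ENNReal.ofReal_mul (by positivity), ← ENNReal.ofReal_mul (by positivity),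
    ← ENNReal.ofReal_add (by positivity) (by positivity)]
  exact ENNReal.ofReal_le_ofReal (h _ _)

theorem le_of_forall_le_one_add_mul {a b : ℝ≥0∞} (hb : b ≠ ∞)
    (h : ∀ η : ℝ, 0 < η → ∃ K : ℝ, ∀ ε : ℝ≥0∞, 0 < ε →
      a ≤ ENNReal.ofReal (1 + η) * b + ENNReal.ofReal K * ε) : a ≤ b := by
  have h1 : ∀ η : ℝ, 0 < η → a ≤ ENNReal.ofReal (1 + η) * b := by
    intro η hη
    obtain ⟨K, hK⟩ := h η hη
    have t : Tendsto (fun ε : ℝ≥0∞ => ENNReal.ofReal (1 + η) * b + ENNReal.ofReal K * ε)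
        (𝓝[>] 0) (𝓝 (ENNReal.ofReal (1 + η) * b + ENNReal.ofReal K * 0)) :=
      tendsto_const_nhds.add (ENNReal.Tendsto.const_mul
        (tendsto_id.mono_left nhdsWithin_le_nhds) (Or.inr ENNReal.ofReal_ne_top))
    rw [mul_zero, add_zero] at t
    exact ge_of_tendsto t (eventually_mem_nhdsWithin.mono hK)
  have t : Tendsto (fun η : ℝ => ENNReal.ofReal (1 + η) * b) (𝓝[>] 0)
      (𝓝 (ENNReal.ofReal (1 + 0) * b)) :=
    ENNReal.Tendsto.mul_const (ENNReal.tendsto_ofReal (tendsto_const_nhds.add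
      (tendsto_id.mono_left nhdsWithin_le_nhds))) (Or.inr hb)
  rw [add_zero, ENNReal.ofReal_one, one_mul] at t
  exact ge_of_tendsto t (eventually_mem_nhdsWithin.mono h1)

theorem IsDoublingYoung.modular_eq_of_approx (hG : IsDoublingYoung G)
    {v : EuclideanSpace ℝ (Fin n) → ℝ} (hv : AEMeasurable v volume) {m : ℝ≥0∞} (hm : m ≠ ∞)
    (h : ∀ ε : ℝ≥0∞, 0 < ε → ∃ w : EuclideanSpace ℝ (Fin n) → ℝ, AEMeasurable w volume ∧
      modular G Ω w = m ∧ modular G Ω (fun x => v x - w x) ≤ ε) : modular G Ω v = m := by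
  have h1 : modular G Ω v ≤ m := by
    refine le_of_forall_le_one_add_mul hm fun η hη => ?_
    obtain ⟨K, hK⟩ := hG.modular_add_le (n := n) (Ω := Ω) hη
    refine ⟨K, fun ε hε => ?_⟩
    obtain ⟨w, hw, hwm, hwe⟩ := h ε hε
    have := hK w (fun x => v x - w x) hw
    simp only [add_sub_cancel] at this
    rw [hwm] at this
    exact this.trans (by gcongr)
  refine h1.antisymm (le_of_forall_le_one_add_mul (ne_top_of_le_ne_top hm h1) fun η hη => ?_)
  obtain ⟨K, hK⟩ := hG.modular_add_le (n := n) (Ω := Ω) hη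
  refine ⟨K, fun ε hε => ?_⟩
  obtain ⟨w, hw, hwm, hwe⟩ := h ε hε
  have := hK v (fun x => w x - v x) hv
  simp only [add_sub_cancel] at this
  rw [hwm] at this
  refine this.trans ?_
  gcongr
  simpa only [modular, abs_sub_comm] using hwe

end ModularConvergence

section DirectMethod

/-- Direct method: a convex functional which is lower semicontinuous under a.e. convergence and
dominates `Φ_{s,G,*}` attains its minimum on `{Φ_{G,Ω} = m}`. -/
theorem IsDoublingYoung.exists_minimizer (hG : IsDoublingYoung G)
    (hs : s ∈ Ioo (0 : ℝ) 1) (hΩo : IsOpen Ω) (hΩb : Bornology.IsBounded Ω) (hΩne : Ω.Nonempty)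
    {m : ℝ≥0∞} (hm : m ≠ ∞) {A : Set (EuclideanSpace ℝ (Fin n) → ℝ)}
    {F : (EuclideanSpace ℝ (Fin n) → ℝ) → ℝ≥0∞} (hA : Convex ℝ A)
    (hAm : ∀ u ∈ A, AEMeasurable u volume)
    (hAc : ∀ (v : ℕ → EuclideanSpace ℝ (Fin n) → ℝ) (w : EuclideanSpace ℝ (Fin n) → ℝ),
      (∀ k, v k ∈ A) → AEMeasurable w volume →
      (∀ᵐ x, Tendsto (fun k => v k x) atTop (𝓝 (w x))) → w ∈ A)
    (hF : ∀ u ∈ A, fracModularStar s G Ω u ≤ F u)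
    (hFc : ∀ u ∈ A, ∀ v ∈ A, ∀ a b : ℝ, 0 ≤ a → 0 ≤ b → a + b = 1 →
      F (a • u + b • v) ≤ ENNReal.ofReal a * F u + ENNReal.ofReal b * F v)
    (hFl : ∀ (v : ℕ → EuclideanSpace ℝ (Fin n) → ℝ) (w : EuclideanSpace ℝ (Fin n) → ℝ),
      (∀ k, v k ∈ A) → (∀ᵐ x, Tendsto (fun k => v k x) atTop (𝓝 (w x))) →
      F w ≤ liminf (fun k => F (v k)) atTop)
    (hne : ∃ u ∈ A, modular G Ω u = m ∧ F u ≠ ∞) :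
    ∃ u ∈ A, modular G Ω u = m ∧ F u ≠ ∞ ∧ ∀ w ∈ A, modular G Ω w = m → F u ≤ F w := by
  set I := sInf (F '' {u | u ∈ A ∧ modular G Ω u = m}) with hI
  have hIle : ∀ w ∈ A, modular G Ω w = m → I ≤ F w := fun w hw hwm =>
    sInf_le (mem_image_of_mem _ ⟨hw, hwm⟩)
  have hItop : I ≠ ∞ := by
    obtain ⟨u, hu, hum, huF⟩ := hne
    exact ne_top_of_le_ne_top huF (hIle u hu hum)
  set c : ℕ → ℝ≥0∞ := fun k => I + ((k : ℝ≥0∞) + 1)⁻¹ with hc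
  have hcanti : Antitone c := fun k l hkl => by simp only [hc]; gcongr
  have hclim : Tendsto c atTop (𝓝 I) := by
    have : Tendsto (fun k : ℕ => ((k + 1 : ℕ) : ℝ≥0∞)⁻¹) atTop (𝓝 0) :=
      ENNReal.tendsto_inv_nat_nhds_zero.comp (tendsto_add_atTop_nat 1)
    simpa [hc] using this.const_add I
  have hex : ∀ k, ∃ u ∈ A, modular G Ω u = m ∧ F u ≤ c k := by
    intro k
    have : I < c k := ENNReal.lt_add_right hItop (by simp)
    obtain ⟨_, ⟨u, ⟨hu, hum⟩, rfl⟩, hlt⟩ := sInf_lt_iff.1 this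
    exact ⟨u, hu, hum, hlt.le⟩
  choose u₀ hu₀A hu₀m hu₀F using hex
  set M := max m (I + 1) with hM
  have hMtop : M ≠ ∞ := by simp [hM, hm, hItop]
  have hc0 : ∀ k, c k ≤ M := fun k => by
    refine (hcanti (Nat.zero_le k)).trans ?_
    simp [hc, hM]
  obtain ⟨φ, hφ, hcauchy⟩ := hG.exists_subseq_modular_cauchy hs hΩo hΩb hΩne hMtop
    (fun k => hAm _ (hu₀A k)) (fun k => (hu₀m k).le.trans (le_max_left _ _))
    (fun k => (hF _ (hu₀A k)).trans ((hu₀F k).trans (hc0 k)))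
  set u : ℕ → EuclideanSpace ℝ (Fin n) → ℝ := fun k => u₀ (φ k) with hu
  have huA : ∀ k, u k ∈ A := fun k => hu₀A _
  have hum : ∀ k, AEMeasurable (u k) volume := fun k => hAm _ (huA k)
  have huF : ∀ k, F (u k) ≤ c k := fun k => (hu₀F _).trans (hcanti (hφ.id_le k))
  obtain ⟨C, hC, hCu⟩ := hG.exists_lintegral_decayMeasure_le hs hΩo hΩb hΩne hMtop
  have hL1 : ∀ k, ∫⁻ y, ENNReal.ofReal |u k y| ∂decayMeasure n ≤ C := fun k =>
    hCu _ (hum k) ((hu₀m _).le.trans (le_max_left _ _))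
      ((hF _ (huA k)).trans ((huF k).trans (hc0 k)))
  have hint : ∀ k, Integrable (u k) (decayMeasure n) := fun k => by
    refine ⟨((hum k).mono_ac decayMeasure_absolutelyContinuous_volume).aestronglyMeasurable, ?_⟩
    rw [hasFiniteIntegral_iff_norm]
    exact (hL1 k).trans_lt hC.lt_top
  have hint' : ∀ k, ∫ y, |u k y| ∂decayMeasure n ≤ C.toReal := fun k => by
    rw [integral_eq_lintegral_of_nonneg_ae (Eventually.of_forall fun y => abs_nonneg _)
      (hint k).abs.1]
    exact ENNReal.toReal_mono hC (hL1 k)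
  obtain ⟨v, w, hv, hw, hlim⟩ := exists_convexCombo_tendsto_ae hint hint'
  replace hlim := volume_absolutelyContinuous_decayMeasure.ae_le hlim
  have hvA : ∀ k, v k ∈ A ∧ F (v k) ≤ c k := by
    intro k
    have hconv : Convex ℝ {f | f ∈ A ∧ F f ≤ c k} := by
      rintro f ⟨hf, hfc⟩ g ⟨hg, hgc⟩ a b ha hb hab
      refine ⟨hA hf hg ha hb hab, ?_⟩
      calc _ ≤ _ := hFc f hf g hg a b ha hb hab
        _ ≤ ENNReal.ofReal a * c k + ENNReal.ofReal b * c k := by gcongr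
        _ = c k := by rw [← add_mul, ← ENNReal.ofReal_add ha hb, hab, ENNReal.ofReal_one, one_mul]
    refine convexHull_min ?_ hconv (hv k)
    rintro _ ⟨i, hi, rfl⟩
    exact ⟨huA i, (huF i).trans (hcanti hi)⟩
  have hvm : ∀ k, AEMeasurable (v k) volume := fun k => hAm _ (hvA k).1
  have hFw : F w ≤ I := by
    refine (hFl v w (fun k => (hvA k).1) hlim).trans ?_
    rw [← hclim.liminf_eq]
    exact liminf_le_liminf (Eventually.of_forall fun k => (hvA k).2)
  refine ⟨w, hAc v w (fun k => (hvA k).1) hw.aemeasurable hlim, ?_, ne_top_of_le_ne_top hItop hFw,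
    fun z hz hzm => hFw.trans (hIle z hz hzm)⟩
  refine hG.modular_eq_of_approx hw.aemeasurable hm fun ε hε => ?_
  obtain ⟨N, hN⟩ := hcauchy ε hε
  refine ⟨u N, hum N, hu₀m _, ?_⟩
  have hvN : ∀ k, modular G Ω (fun x => v (k + N) x - u N x) ≤ ε := fun k => by
    refine (convexHull_min ?_ (hG.convex_modular_sub_le (hum N) ε) (hv (k + N))).2
    rintro _ ⟨i, hi, rfl⟩
    exact ⟨hum i, hN i ((Nat.le_add_left N k).trans hi) N le_rfl⟩
  refine (hG.modular_le_liminf (v := fun k x => v (k + N) x - u N x)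
    (fun k => (hvm _).sub (hum N)) ?_).trans ?_
  · filter_upwards [hlim] with x hx
    exact ((tendsto_add_atTop_iff_nat N).2 hx).sub_const _
  · refine (liminf_le_liminf (Eventually.of_forall hvN)).trans ?_
    simp

end DirectMethod

section Scaling

theorem IsDoublingYoung.lintegral_const_mul_le (hG : IsDoublingYoung G) (L : ℝ) :
    ∃ K : ℝ, ∀ {α : Type} [MeasurableSpace α] (ν : Measure α) (c f : α → ℝ), (∀ x, 0 ≤ c x) →
      ∫⁻ x, ENNReal.ofReal (c x * G |L * f x|) ∂ν
        ≤ ENNReal.ofReal K * ∫⁻ x, ENNReal.ofReal (c x * G |f x|) ∂ν := by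
  obtain ⟨K, hK, h⟩ := hG.doubling L
  refine ⟨K, fun ν c f hc => ?_⟩
  rw [← lintegral_const_mul' _ _ ENNReal.ofReal_ne_top]
  refine lintegral_mono fun x => ?_
  rw [← ENNReal.ofReal_mul hK.le]
  refine ENNReal.ofReal_le_ofReal ?_
  calc c x * G |L * f x| ≤ c x * (K * G |f x|) := mul_le_mul_of_nonneg_left (h _) (hc x)
    _ = _ := by ring

theorem IsDoublingYoung.modular_smul_ne_top (hG : IsDoublingYoung G)
    {u : EuclideanSpace ℝ (Fin n) → ℝ} (hu : modular G Ω u ≠ ∞) (L : ℝ) :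
    modular G Ω (L • u) ≠ ∞ := by
  obtain ⟨K, hK⟩ := hG.lintegral_const_mul_le L
  have := hK (volume.restrict Ω) (fun _ => 1) u fun _ => zero_le_one
  simp only [one_mul] at this
  exact ne_top_of_le_ne_top (ENNReal.mul_ne_top ENNReal.ofReal_ne_top hu) this

theorem IsDoublingYoung.fracModularOn_smul_ne_top (hG : IsDoublingYoung G)
    {A : Set (EuclideanSpace ℝ (Fin n) × EuclideanSpace ℝ (Fin n))}
    {u : EuclideanSpace ℝ (Fin n) → ℝ} (hu : fracModularOn s G A u ≠ ∞) (L : ℝ) :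
    fracModularOn s G A (L • u) ≠ ∞ := by
  obtain ⟨K, hK⟩ := hG.lintegral_const_mul_le L
  have h := hK (volume.restrict A) (fun z => (‖z.1 - z.2‖ ^ n)⁻¹)
    (fun z => holderQuotient s u z.1 z.2) fun z => by positivity
  have e : ∀ x y, L * holderQuotient s u x y = holderQuotient s (L • u) x y := fun x y => by
    simp only [holderQuotient, Pi.smul_apply, smul_eq_mul]; ring
  simp only [e, ← div_eq_inv_mul] at h
  exact ne_top_of_le_ne_top (ENNReal.mul_ne_top ENNReal.ofReal_ne_top hu) h

theorem IsDoublingYoung.exists_smul_modular_eq (hG : IsDoublingYoung G)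
    {u : EuclideanSpace ℝ (Fin n) → ℝ} (hu : AEMeasurable u volume) (h0 : modular G Ω u ≠ 0)
    (hfin : modular G Ω u ≠ ∞) {μ : ℝ} (hμ : 0 ≤ μ) :
    ∃ L : ℝ, modular G Ω (L • u) = ENNReal.ofReal μ := by
  set f : ℝ → ℝ := fun L => (modular G Ω (L • u)).toReal with hf
  have hf0 : f 0 = 0 := by simp [hf, modular, hG.zero]
  have hconv : ConvexOn ℝ univ f := by
    refine ⟨convex_univ, fun x _ y _ a b ha hb hab => ?_⟩
    have h := hG.lintegral_combo_le (ν := volume.restrict Ω) (c := fun _ => 1)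
      (f := x • u) (g := y • u) aemeasurable_const
      (Eventually.of_forall fun _ => zero_le_one) (hu.const_smul x).restrict ha hb hab
    simp only [one_mul] at h
    have e : ∀ z, a * (x • u) z + b * (y • u) z = ((a * x + b * y) • u) z := fun z => by
      simp only [Pi.smul_apply, smul_eq_mul]; ring
    simp only [e] at h
    have ht := fun L => hG.modular_smul_ne_top (Ω := Ω) hfin L
    have h' := ENNReal.toReal_mono (ENNReal.add_ne_top.2
      ⟨ENNReal.mul_ne_top ENNReal.ofReal_ne_top (ht x),
        ENNReal.mul_ne_top ENNReal.ofReal_ne_top (ht y)⟩) h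
    rw [ENNReal.toReal_add (ENNReal.mul_ne_top ENNReal.ofReal_ne_top (ht x))
      (ENNReal.mul_ne_top ENNReal.ofReal_ne_top (ht y)), ENNReal.toReal_mul, ENNReal.toReal_mul,
      ENNReal.toReal_ofReal ha, ENNReal.toReal_ofReal hb] at h'
    exact h'
  have hcont : Continuous f := continuousOn_univ.1 (hconv.continuousOn isOpen_univ)
  have hf1 : 0 < f 1 := by
    simp only [hf, one_smul]
    exact ENNReal.toReal_pos h0 hfin
  set L := max 1 (μ / f 1) with hL
  have hL1 : 1 ≤ L := le_max_left _ _
  have hL0 : 0 < L := by linarith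
  have hfL : μ ≤ f L := by
    have h := hconv.2 (mem_univ L) (mem_univ (0 : ℝ)) (inv_nonneg.2 hL0.le)
      (sub_nonneg.2 (inv_le_one_of_one_le₀ hL1)) (by ring)
    simp only [smul_eq_mul, mul_zero, add_zero, hf0, inv_mul_cancel₀ hL0.ne'] at h
    have h2 : L * f 1 ≤ f L := by
      rwa [inv_mul_eq_div, le_div_iff₀ hL0, mul_comm] at h
    have h3 : μ / f 1 ≤ L := le_max_right _ _
    rw [div_le_iff₀ hf1] at h3
    linarith
  obtain ⟨l, -, hl⟩ := intermediate_value_Icc hL0.le hcont.continuousOn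
    (show μ ∈ Icc (f 0) (f L) from ⟨by rw [hf0]; exact hμ, hfL⟩)
  refine ⟨l, ?_⟩
  rw [← hl, hf, ENNReal.ofReal_toReal (hG.modular_smul_ne_top hfin l)]

end Scaling

section ConeFunction

theorem lintegral_kernel_lt_top (hn : 1 ≤ n) (hs : s ∈ Ioo (0 : ℝ) 1) :
    ∫⁻ h : EuclideanSpace ℝ (Fin n), ENNReal.ofReal
      ((if ‖h‖ ≤ 1 then ‖h‖ ^ (1 - s) else ‖h‖ ^ (-s)) / ‖h‖ ^ n) < ∞ := by
  have : NeZero n := ⟨by omega⟩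
  set f : ℝ → ℝ := fun t => (if t ≤ 1 then t ^ (1 - s) else t ^ (-s)) / t ^ n with hf
  have hi : Integrable (fun h : EuclideanSpace ℝ (Fin n) => f ‖h‖) volume := by
    rw [integrable_fun_norm_addHaar]
    simp only [finrank_euclideanSpace_fin, smul_eq_mul]
    rw [← Ioc_union_Ioi_eq_Ioi zero_le_one]
    have hpow : ∀ t : ℝ, 0 < t → t ^ (n - 1) / t ^ n = t⁻¹ := fun t ht => by
      obtain ⟨k, rfl⟩ : ∃ k, n = k + 1 := ⟨n - 1, by omega⟩
      rw [Nat.add_sub_cancel, pow_succ]; field_simp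
    refine IntegrableOn.union ?_ ?_
    · have h1 : IntegrableOn (fun t : ℝ => t ^ (-s)) (Ioc 0 1) := by
        rw [← intervalIntegrable_iff_integrableOn_Ioc_of_le zero_le_one]
        exact intervalIntegral.intervalIntegrable_rpow' (by linarith [hs.2])
      refine h1.congr_fun (fun t ht => ?_) measurableSet_Ioc
      simp only [hf, if_pos ht.2]
      rw [mul_div_left_comm, hpow t ht.1, ← Real.rpow_neg_one t, ← Real.rpow_add ht.1]
      congr 1; ring
    · have h1 : IntegrableOn (fun t : ℝ => t ^ (-s - 1)) (Ioi 1) :=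
        integrableOn_Ioi_rpow_of_lt (by linarith [hs.1]) one_pos
      refine h1.congr_fun (fun t ht => ?_) measurableSet_Ioi
      have ht0 : 0 < t := one_pos.trans ht
      simp only [hf, if_neg (not_le.2 (show 1 < t from ht))]
      rw [mul_div_left_comm, hpow t ht0, ← Real.rpow_neg_one t, ← Real.rpow_add ht0]
      rfl
  have := hi.hasFiniteIntegral
  rw [hasFiniteIntegral_iff_ofReal (Eventually.of_forall fun h => ?_)] at this
  · exact this
  · simp only [hf, Pi.zero_apply]; positivity

/-- The cone `x ↦ (r - |x - x₀|)₊`. -/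
noncomputable def cone (x₀ : EuclideanSpace ℝ (Fin n)) (r : ℝ)
    (x : EuclideanSpace ℝ (Fin n)) : ℝ := max 0 (r - ‖x - x₀‖)

variable {x₀ : EuclideanSpace ℝ (Fin n)} {r : ℝ}

theorem measurable_cone : Measurable (cone x₀ r) := by unfold cone; fun_prop

theorem cone_eq_zero {x : EuclideanSpace ℝ (Fin n)} (hx : x ∉ Metric.ball x₀ r) :
    cone x₀ r x = 0 := by
  rw [Metric.mem_ball, dist_eq_norm, not_lt] at hx
  exact max_eq_left (by linarith)

theorem abs_cone_le (hr : 0 ≤ r) (x : EuclideanSpace ℝ (Fin n)) : |cone x₀ r x| ≤ r := by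
  rw [abs_of_nonneg (le_max_left _ _)]
  exact max_le hr (by linarith [norm_nonneg (x - x₀)])

theorem abs_cone_sub_le_norm (x y : EuclideanSpace ℝ (Fin n)) :
    |cone x₀ r x - cone x₀ r y| ≤ ‖x - y‖ := by
  refine (abs_max_sub_max_le_max _ _ _ _).trans ?_
  rw [sub_self, abs_zero, sub_sub_sub_cancel_left, abs_sub_comm]
  refine max_le (norm_nonneg _) ((abs_norm_sub_norm_le _ _).trans ?_)
  rw [sub_sub_sub_cancel_right]

theorem abs_cone_sub_le (hr : 0 ≤ r) (x y : EuclideanSpace ℝ (Fin n)) :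
    |cone x₀ r x - cone x₀ r y| ≤ r := by
  have h1 := abs_cone_le (x₀ := x₀) hr x
  have h2 := abs_cone_le (x₀ := x₀) hr y
  have h3 : 0 ≤ cone x₀ r x := le_max_left _ _
  have h4 : 0 ≤ cone x₀ r y := le_max_left _ _
  rw [abs_of_nonneg h3] at h1
  rw [abs_of_nonneg h4] at h2
  rw [abs_le]; constructor <;> linarith

theorem IsDoublingYoung.kernel_cone_le (hG : IsDoublingYoung G) (hs : s ∈ Ioo (0 : ℝ) 1)
    (hr : 0 < r) (x y : EuclideanSpace ℝ (Fin n)) :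
    G |holderQuotient s (cone x₀ r) x y| / ‖x - y‖ ^ n ≤ max (G 1) (G r) *
      ((if ‖x - y‖ ≤ 1 then ‖x - y‖ ^ (1 - s) else ‖x - y‖ ^ (-s)) / ‖x - y‖ ^ n) := by
  rw [← mul_div_assoc]
  refine div_le_div_of_nonneg_right ?_ (by positivity)
  set t := ‖x - y‖ with ht
  have hC : 0 < max (G 1) (G r) := (hG.pos 1 one_pos).trans_le (le_max_left _ _)
  rcases eq_or_lt_of_le (norm_nonneg (x - y)) with h0 | h0
  · have : x = y := sub_eq_zero.1 (norm_eq_zero.1 h0.symm)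
    subst this
    rw [holderQuotient, sub_self, zero_div, abs_zero, hG.zero]
    positivity
  rw [← ht] at h0
  have hts : 0 < t ^ s := Real.rpow_pos_of_pos h0 s
  split_ifs with h1
  · calc G |holderQuotient s (cone x₀ r) x y| ≤ G |t ^ (1 - s) * 1| := by
          refine hG.mono ?_
          rw [holderQuotient, abs_div, abs_of_pos hts, mul_one,
            abs_of_pos (Real.rpow_pos_of_pos h0 _), Real.rpow_sub h0, Real.rpow_one]
          gcongr
          exact abs_cone_sub_le_norm x y
      _ ≤ t ^ (1 - s) * G |1| :=
          hG.mul_le (by positivity) (Real.rpow_le_one h0.le h1 (by linarith [hs.2])) _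
      _ ≤ _ := by
          rw [abs_one, mul_comm]; gcongr; exact le_max_left _ _
  · calc G |holderQuotient s (cone x₀ r) x y| ≤ G |t ^ (-s) * r| := by
          refine hG.mono ?_
          rw [holderQuotient, abs_div, abs_of_pos hts,
            abs_of_pos (show 0 < t ^ (-s) * r by positivity), Real.rpow_neg h0.le, inv_mul_eq_div]
          gcongr
          exact abs_cone_sub_le hr.le x y
      _ ≤ t ^ (-s) * G |r| := hG.mul_le (by positivity)
          (Real.rpow_le_one_of_one_le_of_nonpos (not_le.1 h1).le (by linarith [hs.1])) _
      _ ≤ _ := by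
          rw [abs_of_pos hr, mul_comm]; gcongr; exact le_max_right _ _

theorem IsDoublingYoung.fracModular_cone_ne_top (hG : IsDoublingYoung G) (hn : 1 ≤ n)
    (hs : s ∈ Ioo (0 : ℝ) 1) (hr : 0 < r) : fracModular s G univ (cone x₀ r) ≠ ∞ := by
  set k : EuclideanSpace ℝ (Fin n) → ℝ≥0∞ := fun h => ENNReal.ofReal
      ((if ‖h‖ ≤ 1 then ‖h‖ ^ (1 - s) else ‖h‖ ^ (-s)) / ‖h‖ ^ n) with hk
  have hkm : Measurable k := by
    refine Measurable.ennreal_ofReal (Measurable.div (Measurable.ite ?_ ?_ ?_) ?_)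
    · exact measurableSet_le (by fun_prop) (by fun_prop)
    all_goals fun_prop
  set B := Metric.ball x₀ r with hB
  set C := ENNReal.ofReal (max (G 1) (G r)) with hC
  have hBm : MeasurableSet B := Metric.isOpen_ball.measurableSet
  have hC0 : 0 ≤ max (G 1) (G r) := ((hG.pos 1 one_pos).trans_le (le_max_left _ _)).le
  have hpt : ∀ z : EuclideanSpace ℝ (Fin n) × EuclideanSpace ℝ (Fin n),
      ENNReal.ofReal (G |holderQuotient s (cone x₀ r) z.1 z.2| / ‖z.1 - z.2‖ ^ n)
        ≤ C * (B.indicator 1 z.1 * k (z.1 - z.2)) + C * (B.indicator 1 z.2 * k (z.1 - z.2)) := by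
    rintro ⟨x, y⟩
    have h1 := ENNReal.ofReal_le_ofReal (hG.kernel_cone_le (x₀ := x₀) hs hr x y)
    rw [ENNReal.ofReal_mul hC0] at h1
    by_cases hx : x ∈ B
    · refine h1.trans (le_add_right ?_)
      simp [hx, hk, hC]
    by_cases hy : y ∈ B
    · refine h1.trans (le_add_left ?_)
      simp [hy, hk, hC]
    · have : holderQuotient s (cone x₀ r) x y = 0 := by
        rw [holderQuotient, cone_eq_zero hx, cone_eq_zero hy, sub_self, zero_div]
      simp [this, hG.zero]
  have hfin : C * (volume B * ∫⁻ h, k h) ≠ ∞ :=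
    ENNReal.mul_ne_top ENNReal.ofReal_ne_top (ENNReal.mul_ne_top measure_ball_lt_top.ne
      (lintegral_kernel_lt_top hn hs).ne)
  have hind : Measurable (B.indicator (1 : EuclideanSpace ℝ (Fin n) → ℝ≥0∞)) :=
    measurable_one.indicator hBm
  have hm1 : Measurable fun z : EuclideanSpace ℝ (Fin n) × EuclideanSpace ℝ (Fin n) =>
      B.indicator (1 : EuclideanSpace ℝ (Fin n) → ℝ≥0∞) z.1 * k (z.1 - z.2) :=
    (hind.comp measurable_fst).mul (hkm.comp (measurable_fst.sub measurable_snd))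
  have hm2 : Measurable fun z : EuclideanSpace ℝ (Fin n) × EuclideanSpace ℝ (Fin n) =>
      B.indicator (1 : EuclideanSpace ℝ (Fin n) → ℝ≥0∞) z.2 * k (z.1 - z.2) :=
    (hind.comp measurable_snd).mul (hkm.comp (measurable_fst.sub measurable_snd))
  have hi1 : ∫⁻ z : EuclideanSpace ℝ (Fin n) × EuclideanSpace ℝ (Fin n),
      B.indicator (1 : EuclideanSpace ℝ (Fin n) → ℝ≥0∞) z.1 * k (z.1 - z.2)
        = volume B * ∫⁻ h, k h := by
    rw [Measure.volume_eq_prod, lintegral_prod _ hm1.aemeasurable]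
    have : ∀ x : EuclideanSpace ℝ (Fin n), ∫⁻ y, B.indicator (1 : EuclideanSpace ℝ (Fin n) → ℝ≥0∞) x * k (x - y)
        = B.indicator (1 : EuclideanSpace ℝ (Fin n) → ℝ≥0∞) x * ∫⁻ h, k h := fun x => by
      rw [lintegral_const_mul _ (by exact hkm.comp (measurable_const.sub measurable_id)),
        lintegral_sub_left_eq_self k x]
    simp only [this]
    rw [lintegral_mul_const _ hind, lintegral_indicator_one hBm]
  have hi2 : ∫⁻ z : EuclideanSpace ℝ (Fin n) × EuclideanSpace ℝ (Fin n),
      B.indicator (1 : EuclideanSpace ℝ (Fin n) → ℝ≥0∞) z.2 * k (z.1 - z.2)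
        = volume B * ∫⁻ h, k h := by
    rw [Measure.volume_eq_prod, lintegral_prod_symm _ hm2.aemeasurable]
    have : ∀ y : EuclideanSpace ℝ (Fin n), ∫⁻ x, B.indicator (1 : EuclideanSpace ℝ (Fin n) → ℝ≥0∞) y * k (x - y)
        = B.indicator (1 : EuclideanSpace ℝ (Fin n) → ℝ≥0∞) y * ∫⁻ h, k h := fun y => by
      rw [lintegral_const_mul _ (by exact hkm.comp (measurable_id.sub measurable_const)),
        lintegral_sub_right_eq_self k y]
    simp only [this]
    rw [lintegral_mul_const _ hind, lintegral_indicator_one hBm]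
  refine ne_top_of_le_ne_top (ENNReal.add_ne_top.2 ⟨hfin, hfin⟩) ?_
  rw [fracModular, fracModularOn, univ_prod_univ, Measure.restrict_univ]
  refine (lintegral_mono hpt).trans (le_of_eq ?_)
  rw [lintegral_add_left (hm1.const_mul C), lintegral_const_mul _ hm1, lintegral_const_mul _ hm2,
    hi1, hi2]

theorem IsDoublingYoung.modular_cone_ne_top (hG : IsDoublingYoung G)
    (hΩb : Bornology.IsBounded Ω) (hr : 0 < r) : modular G Ω (cone x₀ r) ≠ ∞ := by
  refine ne_top_of_le_ne_top (b := ENNReal.ofReal (G r) * volume Ω)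
    (ENNReal.mul_ne_top ENNReal.ofReal_ne_top hΩb.measure_lt_top.ne) ?_
  rw [← Measure.restrict_apply_univ Ω, ← lintegral_const]
  refine lintegral_mono fun x => ENNReal.ofReal_le_ofReal ?_
  have := hG.mono (x := cone x₀ r x) (y := r) (by rw [abs_of_pos hr]; exact abs_cone_le hr.le x)
  rwa [abs_of_pos hr] at this

theorem IsDoublingYoung.modular_cone_ne_zero (hG : IsDoublingYoung G) (hr : 0 < r)
    (hball : Metric.ball x₀ r ⊆ Ω) : modular G Ω (cone x₀ r) ≠ 0 := by
  have hpos : 0 < ENNReal.ofReal (G (r / 2)) * volume (Metric.ball x₀ (r / 2)) :=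
    ENNReal.mul_pos (ENNReal.ofReal_pos.2 (hG.pos _ (half_pos hr))).ne'
      (Metric.measure_ball_pos volume x₀ (half_pos hr)).ne'
  refine (hpos.trans_le ?_).ne'
  rw [← setLIntegral_const]
  refine (setLIntegral_mono' Metric.isOpen_ball.measurableSet fun x hx => ?_).trans
    (lintegral_mono_set ((Metric.ball_subset_ball (half_le_self hr.le)).trans hball))
  refine ENNReal.ofReal_le_ofReal ?_
  rw [Metric.mem_ball, dist_eq_norm] at hx
  have h1 : r / 2 ≤ cone x₀ r x := le_max_of_le_right (by linarith)
  have := hG.mono (x := r / 2) (y := cone x₀ r x)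
    (by rw [abs_of_pos (half_pos hr)]; exact h1.trans (le_abs_self _))
  rwa [abs_of_pos (half_pos hr)] at this

/-- A function vanishing outside `Ω` with prescribed modular and finite `Φ_{s,G,ℝⁿ}`. -/
theorem IsDoublingYoung.exists_admissible (hG : IsDoublingYoung G) (hn : 1 ≤ n)
    (hs : s ∈ Ioo (0 : ℝ) 1) (hΩo : IsOpen Ω) (hΩb : Bornology.IsBounded Ω) (hΩne : Ω.Nonempty)
    {μ : ℝ} (hμ : 0 ≤ μ) :
    ∃ u : EuclideanSpace ℝ (Fin n) → ℝ, Measurable u ∧ (∀ x ∉ Ω, u x = 0) ∧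
      modular G Ω u = ENNReal.ofReal μ ∧ fracModular s G univ u ≠ ∞ := by
  obtain ⟨x₀, hx₀⟩ := hΩne
  obtain ⟨r, hr, hball⟩ := Metric.isOpen_iff.1 hΩo x₀ hx₀
  obtain ⟨L, hL⟩ := hG.exists_smul_modular_eq measurable_cone.aemeasurable
    (hG.modular_cone_ne_zero hr hball) (hG.modular_cone_ne_top hΩb hr) hμ
  refine ⟨L • cone x₀ r, measurable_cone.const_smul L, fun x hx => ?_, hL,
    hG.fracModularOn_smul_ne_top (hG.fracModular_cone_ne_top hn hs hr) L⟩
  rw [Pi.smul_apply, cone_eq_zero fun h => hx (hball h), smul_zero]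

end ConeFunction

section Attainment

theorem eq_biInf_of_forall_le {ι : Type*} {C : Set ι} {Q : ι → ℝ≥0∞} {u : ι} (hu : u ∈ C)
    (h : ∀ w ∈ C, Q u ≤ Q w) : Q u = ⨅ w ∈ C, Q w :=
  le_antisymm (le_iInf₂ h) (iInf₂_le u hu)

theorem liminf_add_liminf_le (a b : ℕ → ℝ≥0∞) :
    liminf a atTop + liminf b atTop ≤ liminf (fun k => a k + b k) atTop := by
  have hmono : ∀ c : ℕ → ℝ≥0∞, Monotone fun i => ⨅ k ≥ i, c k := fun c i j hij =>
    biInf_mono fun k hk => hij.trans hk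
  simp only [liminf_eq_iSup_iInf_of_nat]
  rw [ENNReal.iSup_add_iSup_of_monotone (hmono a) (hmono b)]
  exact iSup_mono fun i => le_iInf₂ fun k hk => add_le_add (iInf₂_le k hk) (iInf₂_le k hk)

theorem fracModularStar_le_fracModular_univ (u : EuclideanSpace ℝ (Fin n) → ℝ) :
    fracModularStar s G Ω u ≤ fracModular s G univ u :=
  lintegral_mono_set (by rw [univ_prod_univ]; exact subset_univ _)

theorem IsDoublingYoung.modular_univ_eq (hG : IsDoublingYoung G) (hΩo : IsOpen Ω)
    {u : EuclideanSpace ℝ (Fin n) → ℝ} (hu : ∀ᵐ x ∂volume.restrict Ωᶜ, u x = 0) :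
    modular G univ u = modular G Ω u := by
  have h0 : ∫⁻ x in Ωᶜ, ENNReal.ofReal (G |u x|) = 0 := by
    rw [← lintegral_zero (μ := volume.restrict Ωᶜ)]
    refine lintegral_congr_ae (hu.mono fun x hx => ?_)
    simp [hx, hG.zero]
  rw [modular, Measure.restrict_univ, ← lintegral_add_compl _ hΩo.measurableSet, h0, add_zero,
    modular]

theorem IsDoublingYoung.exists_const_modular_eq (hG : IsDoublingYoung G) (hΩo : IsOpen Ω)
    (hΩb : Bornology.IsBounded Ω) (hΩne : Ω.Nonempty) {μ : ℝ} (hμ : 0 ≤ μ) :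
    ∃ c : ℝ, modular G Ω (fun _ => c) = ENNReal.ofReal μ := by
  have e : modular G Ω (fun _ => 1) = ENNReal.ofReal (G 1) * volume Ω := by
    simp [modular]
  obtain ⟨c, hc⟩ := hG.exists_smul_modular_eq (Ω := Ω) (u := fun _ => 1) aemeasurable_const
    (by
      rw [e]
      exact mul_ne_zero (ENNReal.ofReal_pos.2 (hG.pos 1 one_pos)).ne'
        (hΩo.measure_pos volume hΩne).ne')
    (by rw [e]; exact ENNReal.mul_ne_top ENNReal.ofReal_ne_top hΩb.measure_lt_top.ne) hμ
  refine ⟨c, ?_⟩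
  rw [← hc]
  congr 1
  ext x
  simp

theorem IsDoublingYoung.fracModularOn_const (hG : IsDoublingYoung G)
    (A : Set (EuclideanSpace ℝ (Fin n) × EuclideanSpace ℝ (Fin n))) (c : ℝ) :
    fracModularOn s G A (fun _ => c) = 0 := by
  simp [fracModularOn, holderQuotient, hG.zero]

theorem IsDoublingYoung.exists_quotientD_eq (hG : IsDoublingYoung G) (hn : 1 ≤ n)
    (hs : s ∈ Ioo (0 : ℝ) 1) (hΩo : IsOpen Ω) (hΩb : Bornology.IsBounded Ω) (hΩne : Ω.Nonempty)
    {μ : ℝ} (hμ : 0 ≤ μ) :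
    ∃ u ∈ constraintSet (WZero s G Ω) G Ω μ, quotientD s G Ω u = LambdaD s G Ω μ := by
  obtain ⟨u, ⟨hum, hu0⟩, huμ, huF, hmin⟩ := hG.exists_minimizer hs hΩo hΩb hΩne
    (m := ENNReal.ofReal μ) ENNReal.ofReal_ne_top
    (A := {u | AEMeasurable u volume ∧ ∀ᵐ x ∂volume.restrict Ωᶜ, u x = 0})
    (F := fracModular s G univ)
    (by
      rintro u ⟨hu, hu0⟩ v ⟨hv, hv0⟩ a b - - -
      refine ⟨(hu.const_smul a).add (hv.const_smul b), ?_⟩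
      filter_upwards [hu0, hv0] with x h1 h2
      simp [h1, h2])
    (fun u hu => hu.1)
    (fun v w hv hw hlim => by
      refine ⟨hw, ?_⟩
      filter_upwards [ae_all_iff.2 fun k => (hv k).2, ae_restrict_of_ae hlim] with x h1 h2
      simp only [h1] at h2
      exact tendsto_nhds_unique h2 tendsto_const_nhds)
    (fun u _ => fracModularStar_le_fracModular_univ u)
    (fun u hu v _ a b ha hb hab => hG.fracModularOn_combo_le hu.1 ha hb hab)
    (fun v w hv hlim => hG.fracModularOn_le_liminf (fun k => (hv k).1) hlim)
    (by
      obtain ⟨u, hu, hu0, huμ, huF⟩ := hG.exists_admissible hn hs hΩo hΩb hΩne hμ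
      exact ⟨u, ⟨hu.aemeasurable, (ae_restrict_mem hΩo.measurableSet.compl).mono hu0⟩, huμ, huF⟩)
  refine ⟨u, ⟨⟨⟨⟨hum.restrict, ?_⟩, huF.lt_top⟩, hu0⟩, huμ⟩,
    eq_biInf_of_forall_le ⟨⟨⟨⟨hum.restrict, ?_⟩, huF.lt_top⟩, hu0⟩, huμ⟩ fun w hw => ?_⟩
  · rw [hG.modular_univ_eq hΩo hu0, huμ]; exact ENNReal.ofReal_lt_top
  · rw [hG.modular_univ_eq hΩo hu0, huμ]; exact ENNReal.ofReal_lt_top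
  · obtain ⟨⟨⟨⟨hwm, -⟩, -⟩, hw0⟩, hwμ⟩ := hw
    rw [Measure.restrict_univ] at hwm
    rw [quotientD, quotientD, huμ, hwμ]
    gcongr
    exact hmin w ⟨hwm, hw0⟩ hwμ

theorem IsDoublingYoung.exists_quotientR_eq (hG : IsDoublingYoung G) (hn : 1 ≤ n)
    (hs : s ∈ Ioo (0 : ℝ) 1) (hΩo : IsOpen Ω) (hΩb : Bornology.IsBounded Ω) (hΩne : Ω.Nonempty)
    {β : EuclideanSpace ℝ (Fin n) → ℝ} (hβ : AEMeasurable β (volume.restrict Ωᶜ))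
    (hβ0 : ∀ᵐ x ∂volume.restrict Ωᶜ, 0 ≤ β x) {μ : ℝ} (hμ : 0 ≤ μ) :
    ∃ u ∈ constraintSet (XSpace s G β Ω) G Ω μ, quotientR s G β Ω u = LambdaR s G β Ω μ := by
  obtain ⟨u, hum, huμ, huF, hmin⟩ := hG.exists_minimizer hs hΩo hΩb hΩne
    (m := ENNReal.ofReal μ) ENNReal.ofReal_ne_top
    (A := {u | AEMeasurable u volume})
    (F := fun u => fracModularStar s G Ω u + weightedModular G β Ωᶜ u)
    (fun u hu v hv a b _ _ _ => AEMeasurable.add (hu.const_smul a) (hv.const_smul b))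
    (fun u hu => hu) (fun v w _ hw _ => hw) (fun u _ => le_self_add)
    (fun u hu v _ a b ha hb hab => by
      refine (add_le_add (hG.fracModularOn_combo_le hu ha hb hab)
        (hG.weightedModular_combo_le hβ hβ0 hu ha hb hab)).trans (le_of_eq ?_)
      simp only [fracModularStar]
      ring)
    (fun v w hv hlim => by
      refine (add_le_add (hG.fracModularOn_le_liminf hv hlim)
        (hG.weightedModular_le_liminf hβ hv hlim)).trans ?_
      exact liminf_add_liminf_le _ _)
    (by
      obtain ⟨u, hu, hu0, huμ, huF⟩ := hG.exists_admissible hn hs hΩo hΩb hΩne hμ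
      refine ⟨u, hu.aemeasurable, huμ, ENNReal.add_ne_top.2
        ⟨ne_top_of_le_ne_top huF (fracModularStar_le_fracModular_univ u), ?_⟩⟩
      rw [weightedModular, setLIntegral_congr_fun hΩo.measurableSet.compl (g := fun _ => 0)
        fun x hx => by simp [hu0 x hx, hG.zero]]
      simp)
  have hX : u ∈ constraintSet (XSpace s G β Ω) G Ω μ := by
    refine ⟨⟨hum, ?_⟩, huμ⟩
    rw [huμ]
    have := ENNReal.add_ne_top.1 huF
    exact (ENNReal.add_ne_top.2 ⟨ENNReal.add_ne_top.2 ⟨this.1, ENNReal.ofReal_ne_top⟩,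
      this.2⟩).lt_top
  refine ⟨u, hX, eq_biInf_of_forall_le hX fun w hw => ?_⟩
  obtain ⟨⟨hwm, -⟩, hwμ⟩ := hw
  rw [quotientR, quotientR, huμ, hwμ, add_right_comm, add_right_comm _ (ENNReal.ofReal μ)]
  gcongr ?_ / _
  exact add_le_add_left (hmin w hwm hwμ) _

theorem IsDoublingYoung.exists_quotientN_eq (hG : IsDoublingYoung G) (hΩo : IsOpen Ω)
    (hΩb : Bornology.IsBounded Ω) (hΩne : Ω.Nonempty) {μ : ℝ} (hμ : 0 ≤ μ) :
    ∃ u ∈ constraintSet (WStar s G Ω) G Ω μ, quotientN s G Ω u = LambdaN s G Ω μ := by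
  obtain ⟨c, hc⟩ := hG.exists_const_modular_eq hΩo hΩb hΩne hμ
  have h0 : fracModularStar s G Ω (fun _ => c) = 0 := hG.fracModularOn_const _ c
  have hW : (fun _ => c) ∈ constraintSet (WStar s G Ω) G Ω μ :=
    ⟨⟨aemeasurable_const, ⟨aemeasurable_const, hc ▸ ENNReal.ofReal_lt_top⟩,
      h0 ▸ ENNReal.zero_lt_top⟩, hc⟩
  refine ⟨_, hW, eq_biInf_of_forall_le hW fun w hw => ?_⟩
  rw [quotientN, quotientN, h0, hc, hw.2]
  gcongr
  exact zero_le

theorem IsDoublingYoung.exists_quotientReg_eq (hG : IsDoublingYoung G) (hΩo : IsOpen Ω)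
    (hΩb : Bornology.IsBounded Ω) (hΩne : Ω.Nonempty) {μ : ℝ} (hμ : 0 ≤ μ) :
    ∃ u ∈ constraintSet (WReg s G Ω) G Ω μ, quotientReg s G Ω u = LambdaReg s G Ω μ := by
  obtain ⟨c, hc⟩ := hG.exists_const_modular_eq hΩo hΩb hΩne hμ
  have h0 : fracModular s G Ω (fun _ => c) = 0 := hG.fracModularOn_const _ c
  have hW : (fun _ => c) ∈ constraintSet (WReg s G Ω) G Ω μ :=
    ⟨⟨⟨aemeasurable_const, hc ▸ ENNReal.ofReal_lt_top⟩, h0 ▸ ENNReal.zero_lt_top⟩, hc⟩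
  refine ⟨_, hW, eq_biInf_of_forall_le hW fun w hw => ?_⟩
  rw [quotientReg, quotientReg, h0, hc, hw.2]
  gcongr
  exact zero_le

end Attainment

end FracOrlicz

theorem mainTheorem4 {n : ℕ} (hn : 1 ≤ n) (s : ℝ) (hs : s ∈ Set.Ioo (0 : ℝ) 1)
    (g G : ℝ → ℝ) (hG : FracOrlicz.IsYoungFunction g G)
    (pm pp : ℝ) (hp : FracOrlicz.GrowthCondition g G pm pp)
    (Ω : Set (EuclideanSpace ℝ (Fin n))) (hΩo : IsOpen Ω)
    (hΩb : Bornology.IsBounded Ω) (hΩne : Ω.Nonempty)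
    (β : EuclideanSpace ℝ (Fin n) → ℝ)
    (hβ : MemLp β ∞ (volume.restrict Ωᶜ))
    (hβpos : ∀ᵐ x ∂(volume.restrict Ωᶜ), 0 < β x)
    (μ : ℝ) (hμ : 0 < μ) :
    (∃ u ∈ FracOrlicz.constraintSet (FracOrlicz.WZero s G Ω) G Ω μ,
      FracOrlicz.quotientD s G Ω u = FracOrlicz.LambdaD s G Ω μ) ∧
    (∃ u ∈ FracOrlicz.constraintSet (FracOrlicz.WStar s G Ω) G Ω μ,
      FracOrlicz.quotientN s G Ω u = FracOrlicz.LambdaN s G Ω μ) ∧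
    (∃ u ∈ FracOrlicz.constraintSet (FracOrlicz.WReg s G Ω) G Ω μ,
      FracOrlicz.quotientReg s G Ω u = FracOrlicz.LambdaReg s G Ω μ) ∧
    (∃ u ∈ FracOrlicz.constraintSet (FracOrlicz.XSpace s G β Ω) G Ω μ,
      FracOrlicz.quotientR s G β Ω u = FracOrlicz.LambdaR s G β Ω μ) := by
  have hY := hG.isDoublingYoung hp
  exact ⟨hY.exists_quotientD_eq hn hs hΩo hΩb hΩne hμ.le,
    hY.exists_quotientN_eq hΩo hΩb hΩne hμ.le,
    hY.exists_quotientReg_eq hΩo hΩb hΩne hμ.le,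
    hY.exists_quotientR_eq hn hs hΩo hΩb hΩne hβ.1.aemeasurable
      (hβpos.mono fun _ hx => hx.le) hμ.le⟩
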